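/- Fix $\beta\in(0,\infty)$. For $n\in\mathbb N$ and $1\le i\le n$ let $q_i=\frac{e^{-\beta i/n}}{1+e^{-\beta i/n}}$. In the linear reliability channel (LRC) with parameter $\beta$, given a reliability ordering permutation $\tau\in S_n$ of $\{1,\dots,n\}$, the bits of $X^n\in\{0,1\}^n$ are received independently, the $i$-th bit being flipped with probability $q_{\tau(i)}$. The soft-decision noise effect $N^n$ has the distribution of $X^n+Y^n$ (mod 2) given the permutation $\tau=\tau_n$, that is, $\Pr(N^n=z)=\prod_{i:z_i=1}q_{\tau(i)}\prod_{i:z_i=0}(1-q_{\tau(i)})$; the hard-decision noise effect $Z^n$ has the average of these distributions over a uniformly random $\tau\in S_n$. An optimal guessing function for a random sequence $W^n\in\{0,1\}^n$ is a bijection $G:\{0,1\}^n\to\{1,\dots,2^n\}$ with $G(x)<G(y)$ whenever $\Pr(W^n=x)>\Pr(W^n=y)$. The guesswork process of $W$ is $A^n=n^{-1}\ln G(W^n)$, with $G$ optimal for $W^n$, and its scaled cumulant generating function (sCGF) is $\Lambda_W(\alpha)=\lim_{n\to\infty}\frac1n\ln \mathbb E[e^{\alpha nA^n}]$, $\alpha\in\mathbb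 R$. The Rényi entropy rate is $H_\alpha(W)=\lim_{n\to\infty}\frac1n\cdot\frac1{1-\alpha}\ln\sum_{x}\Pr(W^n=x)^\alpha$ for $\alpha\in(0,1)\cup(1,\infty)$, and $H_{\min}(W)=\lim_{\alpha\to\infty}H_\alpha(W)$, $H_1(W)=\lim_{\alpha\to1}H_\alpha(W)$ are the min-entropy rate and the Shannon entropy rate. **Theorem.** For $W=N$ (soft decision) and $W=Z$ (hard decision) these limits exist; for $W=N$ they do not depend on the sequence of permutations $\tau_n\in S_n$, and the sCGF does not depend on the choice of the optimal guessing functions. Let $$I_W(x)=\sup_{\alpha\in\mathbb R}\{x\alpha-\Lambda_W(\alpha)\},\qquad x\in\mathbb R,$$ be the Legendre–Fenchel transform of the sCGF. Then $I_W$ is lower semicontinuous, has values in $[0,\infty)$ and is convex on $[0,\ln 2]$, equals $+\infty$ outside $[0,\ln 2]$, and the guesswork process $n^{-1}\ln G(W^n)$ satisfies the large deviation principle with rate function $I_W$: for every open $U\subseteq\mathbb R$ and every closed $F\subseteq\mathbb R$, $$-\inf_{x\in U}I_W(x)\le\liminf_{n\to\infty}\tfrac1n\ln\Pr(A^n\in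 U),\qquad \limsup_{n\to\infty}\tfrac1n\ln\Pr(A^n\in F)\le-\inf_{x\in F}I_W(x).$$ Furthermore: 1. $I_W(0)=H_{\min}(W)$; 2. $I_W(x)=0$ if and only if $x=H_1(W)$; 3. $I_W$ is strictly convex on $[0,\ln 2]$. -/

import Mathlib

open Filter Topology MeasureTheory
open scoped ENNReal

noncomputable section

namespace LRC

/-- Binary sequences of length `n`. -/
abbrev BitString (n : ℕ) : Type := Fin n → ZMod 2

/-! ### The linear reliability channel

The index `i : Fin n` stands for the (1-based) position `i + 1`. -/

/-- The bit-flip probability `q_i = e^{-β i / n} / (1 + e^{-β i / n})`, `1 ≤ i ≤ n`. -/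
def flipProb (β : ℝ) (n : ℕ) (i : Fin n) : ℝ :=
  Real.exp (-β * ((i : ℝ) + 1) / n) / (1 + Real.exp (-β * ((i : ℝ) + 1) / n))

/-- The probability of receiving `y` when `x` is sent and the reliability ordering permutation
is `τ`: the bits pass independently through binary symmetric channels with flip
probabilities `q_{τ(i)}`. -/
def transitionProb (β : ℝ) {n : ℕ} (τ : Equiv.Perm (Fin n)) (x y : BitString n) : ℝ :=
  ∏ i, if y i = x i then 1 - flipProb β n (τ i) else flipProb β n (τ i)

/-- The PMF of the soft-decision noise effect `X + Y` given `T = τ`, evaluated with input `0`;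
it is the same for every input, see `transitionProb_add`. -/
def softNoise (β : ℝ) {n : ℕ} (τ : Equiv.Perm (Fin n)) (z : BitString n) : ℝ :=
  transitionProb β τ 0 z

theorem transitionProb_add (β : ℝ) {n : ℕ} (τ : Equiv.Perm (Fin n)) (x z : BitString n) :
    transitionProb β τ x (x + z) = softNoise β τ z := by
  simp [softNoise, transitionProb]

/-- The PMF of the hard-decision noise effect: the average over a uniformly random
reliability ordering permutation. -/
def hardNoise (β : ℝ) (n : ℕ) (z : BitString n) : ℝ :=
  ((n.factorial : ℝ))⁻¹ * ∑ τ : Equiv.Perm (Fin n), softNoise β τ z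

/-! ### Guesswork -/

/-- `G` is an optimal guessing function for the PMF `p`: a bijection onto `{1, …, 2^n}` which
ranks sequences in non-increasing order of probability. -/
def IsOptimalGuessing {n : ℕ} (p : BitString n → ℝ) (G : BitString n → ℕ) : Prop :=
  Set.BijOn G Set.univ (Set.Icc 1 (2 ^ n)) ∧ ∀ x y, p y < p x → G x < G y

/-- The law of `n⁻¹ ln G(X)` on the real line, for `X` with PMF `p`. -/
def guessworkLaw {n : ℕ} (p : BitString n → ℝ) (G : BitString n → ℕ) : Measure ℝ :=
  ∑ x, ENNReal.ofReal (p x) • Measure.dirac ((n : ℝ)⁻¹ * Real.log (G x))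

/-! ### Large deviations -/

/-- `Λ` is the scaled cumulant generating function of a real-valued process with laws `μ n`:
`Λ(α) = lim n⁻¹ ln E[exp(α n Aⁿ)]`, the limit existing for every real `α`. -/
def HasSCGF (μ : ℕ → Measure ℝ) (Λ : ℝ → ℝ) : Prop :=
  ∀ α : ℝ, Tendsto (fun n : ℕ => (n : ℝ)⁻¹ * Real.log (∫ a, Real.exp (α * n * a) ∂(μ n)))
    atTop (𝓝 (Λ α))

/-- The Legendre–Fenchel transform, with values in the extended reals. -/
def legendreFenchel (Λ : ℝ → ℝ) (x : ℝ) : EReal :=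
  ⨆ α : ℝ, ((x * α - Λ α : ℝ) : EReal)

/-- The (full) large deviation principle with speed `n` for laws `μ n` on the real line.
`ExpGrowth.expGrowthInf u` and `ExpGrowth.expGrowthSup u` are the lower and upper limits
of `ln (u n) / n`. -/
def SatisfiesLDP (μ : ℕ → Measure ℝ) (I : ℝ → EReal) : Prop :=
  (∀ U : Set ℝ, IsOpen U → -(⨅ x ∈ U, I x) ≤ ExpGrowth.expGrowthInf fun n => μ n U) ∧
  (∀ F : Set ℝ, IsClosed F → (ExpGrowth.expGrowthSup fun n => μ n F) ≤ -(⨅ x ∈ F, I x))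

/-! ### Entropy rates -/

/-- The Rényi entropy of order `α` in nats, for `α ∈ (0,1) ∪ (1,∞)`. -/
def renyiEntropy {n : ℕ} (α : ℝ) (p : BitString n → ℝ) : ℝ :=
  1 / (1 - α) * Real.log (∑ x, p x ^ α)

/-- `H α` is the Rényi entropy rate of order `α`, for all `α ∈ (0,1) ∪ (1,∞)`. -/
def HasRenyiRates (p : ∀ n, BitString n → ℝ) (H : ℝ → ℝ) : Prop :=
  ∀ α : ℝ, 0 < α → α ≠ 1 →
    Tendsto (fun n : ℕ => (n : ℝ)⁻¹ * renyiEntropy α (p n)) atTop (𝓝 (H α))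

/-- `h` is the min-entropy rate, the limit of the Rényi entropy rates as the order tends
to `∞`. -/
def HasMinEntropyRate (p : ∀ n, BitString n → ℝ) (h : ℝ) : Prop :=
  ∃ H : ℝ → ℝ, HasRenyiRates p H ∧ Tendsto H atTop (𝓝 h)

/-- `h` is the Shannon entropy rate, the limit of the Rényi entropy rates as the order tends
to `1`. -/
def HasShannonEntropyRate (p : ∀ n, BitString n → ℝ) (h : ℝ) : Prop :=
  ∃ H : ℝ → ℝ, HasRenyiRates p H ∧ Tendsto H (𝓝[≠] 1) (𝓝 h)

/-- The regularity and the listed properties of a guesswork rate function `I`: it is lower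
semicontinuous, finite and non-negative on `[0, ln 2]` (and `+∞` elsewhere), convex, has
`I(0) = hmin`, vanishes exactly at `hone`, and is strictly convex on `[0, ln 2]`. -/
structure IsGuessworkRateFunction (I : ℝ → EReal) (hmin hone : ℝ) : Prop where
  lowerSemicontinuous : LowerSemicontinuous I
  nonneg : ∀ x, 0 ≤ I x
  finite : ∀ x ∈ Set.Icc 0 (Real.log 2), I x < ⊤
  top_of_notMem : ∀ x, x ∉ Set.Icc 0 (Real.log 2) → I x = ⊤
  convex : ConvexOn ℝ (Set.Icc 0 (Real.log 2)) fun x => (I x).toReal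
  at_zero : I 0 = (hmin : EReal)
  eq_zero_iff : ∀ x, I x = 0 ↔ x = hone
  strictConvex : StrictConvexOn ℝ (Set.Icc 0 (Real.log 2)) fun x => (I x).toReal

end LRC

end

namespace LRC

open ProbabilityTheory

/-! ### Convexity of cumulant generating functions -/

/-! Everything needed from the channel is one function: the rate `T s` of `ln ∑ (p x / p 0) ^ s` for
`s > 0`, with `0` the most likely word. Both noise laws satisfy `HasPowerSumRates`: `T` exists, is
differentiable, and vanishes at infinity.

Arikan's inequalities compare `E[G ^ α]` with `(∑ p ^ (1/(1+α))) ^ (1+α)` for `α > -1`, and with `p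
0` for `α ≤ -1`; the loss is a power of the harmonic sum `∑ 1/G ≤ 1 + n ln 2`, invisible on the
exponential scale. Hence `Λ α = (1+α) T(1/(1+α)) - T 1` for `α > -1` and `Λ α = -T 1` for `α ≤ -1`.
The two branches join differentiably at `-1` because `T → 0`.

The rest is convex duality. `Λ` is convex as a limit of cumulant generating functions, it is
differentiable, and its slopes fill `(0, ln 2)`. Chernoff bounds give the upper bound of the LDP;
tilting gives the lower bound at every slope, and convexity of the transform carries it to the
endpoints. Differentiability of `Λ` makes the transform strictly convex, with unique zero `Λ' 0 = T
1 - T' 1`, the Shannon rate; its value at `0` is `-min Λ = T 1`, the min-entropy rate.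

Soft decision: the power sum factorises over the bits, the permutation drops out, and a Riemann sum
gives `T s = ∫₀¹ ln (1 + e^{-sβu}) du`.

Hard decision: after averaging, the probability depends only on the Hamming weight `k`; relative to
the zero word it is `e_k(q, …, qⁿ) / C(n,k)` with `q = e^{-β/n}`. The `q`-binomial recursion turns
its logarithm into Riemann sums of the cumulant generating function of the uniform law, so it is `-n
c(k/n) + O(1)` with `c` convex. As `C(n,k) ≈ e^{n h(k/n)}`, Laplace's principle gives `T s = max (h
- s c)` over `[0, 1]`. Strict concavity of the binary entropy `h` makes the maximiser unique, and
Danskin's theorem then gives differentiability (`hasDerivAt_of_unique_isMaxOn`); `T → 0` because `c`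
grows at least linearly. -/

theorem convexOn_cgf {Ω : Type*} {m : MeasurableSpace Ω} {X : Ω → ℝ} {μ : Measure Ω}
    (h : ∀ t, Integrable (fun ω => Real.exp (t * X ω)) μ) :
    ConvexOn ℝ Set.univ (cgf X μ) := by
  have huniv : integrableExpSet X μ = Set.univ := Set.eq_univ_of_forall h
  have hint : ∀ v, v ∈ interior (integrableExpSet X μ) := by simp [huniv]
  refine convexOn_univ_of_deriv2_nonneg (fun v => (analyticAt_cgf (hint v)).differentiableAt)
    (fun v => (analyticAt_cgf (hint v)).deriv.differentiableAt) fun v => ?_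
  -- The second derivative is the variance of `X` under the exponentially tilted law.
  rw [← iteratedDeriv_eq_iterate, iteratedDeriv_two_cgf_eq_integral (hint v)]
  exact div_nonneg (integral_nonneg fun ω => by positivity) mgf_nonneg

theorem cgf_id_eq (μ : Measure ℝ) (α : ℝ) (n : ℕ) :
    Real.log (∫ a, Real.exp (α * n * a) ∂μ) = cgf id μ (α * n) := rfl

theorem HasSCGF.convexOn {μ : ℕ → Measure ℝ} {Λ : ℝ → ℝ}
    (hint : ∀ n t, Integrable (fun a => Real.exp (t * a)) (μ n)) (h : HasSCGF μ Λ) :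
    ConvexOn ℝ Set.univ Λ := by
  refine ⟨convex_univ, fun x _ y _ a b ha hb hab => ?_⟩
  refine le_of_tendsto_of_tendsto (h (a • x + b • y)) (((h x).const_smul a).add
    ((h y).const_smul b)) (Eventually.of_forall fun n => ?_)
  simp only [cgf_id_eq, smul_eq_mul]
  have := (convexOn_cgf (X := id) (hint n)).2 (Set.mem_univ (x * n)) (Set.mem_univ (y * n))
    ha hb hab
  simp only [smul_eq_mul] at this
  have h2 : (a * x + b * y) * (n : ℝ) = a * (x * n) + b * (y * n) := by ring
  rw [h2]
  have h3 := mul_le_mul_of_nonneg_left this (inv_nonneg.2 (Nat.cast_nonneg n : (0 : ℝ) ≤ n))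
  linarith

theorem HasSCGF.zero {μ : ℕ → Measure ℝ} {Λ : ℝ → ℝ} [∀ n, IsProbabilityMeasure (μ n)]
    (h : HasSCGF μ Λ) : Λ 0 = 0 :=
  tendsto_nhds_unique (h 0) (by simp)

theorem add_mul_sub_le_of_convexOn {Λ : ℝ → ℝ} (hc : ConvexOn ℝ Set.univ Λ) {a m : ℝ}
    (hm : HasDerivAt Λ m a) (b : ℝ) : Λ a + m * (b - a) ≤ Λ b := by
  rcases lt_trichotomy a b with hab | rfl | hab
  · have := hc.le_slope_of_hasDerivAt trivial trivial hab hm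
    rw [slope_def_field, le_div_iff₀ (by linarith)] at this
    linarith
  · simp
  · have := hc.slope_le_of_hasDerivAt trivial trivial hab hm
    rw [slope_def_field, div_le_iff₀ (by linarith)] at this
    linarith

/-! ### The Gärtner–Ellis theorem on the line -/

section GartnerEllis

variable {μ : ℕ → Measure ℝ} {Λ : ℝ → ℝ} [∀ n, IsProbabilityMeasure (μ n)]

theorem expGrowthSup_le_of_forall_le_exp_cgf {S : Set ℝ}
    (hΛ : HasSCGF μ Λ) (α b : ℝ)
    (h : ∀ n, (μ n).real S ≤ Real.exp (-(α * n) * b + cgf id (μ n) (α * n))) :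
    ExpGrowth.expGrowthSup (fun n => μ n S) ≤ ((-(b * α - Λ α) : ℝ) : EReal) := by
  rw [← EReal.le_of_forall_lt_iff_le]
  intro z hz
  rw [EReal.coe_lt_coe_iff] at hz
  apply Eventually.expGrowthSup_le
  have h1 : ∀ᶠ n : ℕ in atTop, (n : ℝ)⁻¹ * cgf id (μ n) (α * n) < z + b * α :=
    (hΛ α).eventually_lt_const (by linarith)
  filter_upwards [h1, eventually_gt_atTop 0] with n hn hn0
  have hn0' : (0 : ℝ) < n := by exact_mod_cast hn0
  rw [inv_mul_lt_iff₀ hn0'] at hn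
  have : ((z : EReal) * (n : EReal)) = ((z * n : ℝ) : EReal) := by
    rw [EReal.coe_mul]; rfl
  rw [this, EReal.exp_coe, ← ENNReal.ofReal_toReal (measure_ne_top (μ n) S)]
  refine ENNReal.ofReal_le_ofReal ((h n).trans (Real.exp_le_exp.2 ?_))
  nlinarith

theorem expGrowthSup_Ici_le (hint : ∀ n t, Integrable (fun a => Real.exp (t * a)) (μ n))
    (hΛ : HasSCGF μ Λ) {α : ℝ} (hα : 0 ≤ α) (b : ℝ) :
    ExpGrowth.expGrowthSup (fun n => μ n (Set.Ici b)) ≤ ((-(b * α - Λ α) : ℝ) : EReal) :=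
  expGrowthSup_le_of_forall_le_exp_cgf hΛ α b fun n =>
    measure_ge_le_exp_cgf (X := id) b (by positivity) (hint n _)

theorem expGrowthSup_Iic_le (hint : ∀ n t, Integrable (fun a => Real.exp (t * a)) (μ n))
    (hΛ : HasSCGF μ Λ) {α : ℝ} (hα : α ≤ 0) (b : ℝ) :
    ExpGrowth.expGrowthSup (fun n => μ n (Set.Iic b)) ≤ ((-(b * α - Λ α) : ℝ) : EReal) :=
  expGrowthSup_le_of_forall_le_exp_cgf hΛ α b fun n =>
    measure_le_le_exp_cgf (X := id) b
      (mul_nonpos_of_nonpos_of_nonneg hα (Nat.cast_nonneg n)) (hint n _)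

theorem legendreFenchel_nonneg {Λ : ℝ → ℝ} (h0 : Λ 0 = 0) (x : ℝ) : 0 ≤ legendreFenchel Λ x :=
  le_iSup_of_le 0 (by simp [h0])

theorem le_legendreFenchel (Λ : ℝ → ℝ) (x α : ℝ) :
    ((x * α - Λ α : ℝ) : EReal) ≤ legendreFenchel Λ x :=
  le_iSup (fun α : ℝ => ((x * α - Λ α : ℝ) : EReal)) α

theorem legendreFenchel_le_iff {Λ : ℝ → ℝ} {x : ℝ} {c : EReal} :
    legendreFenchel Λ x ≤ c ↔ ∀ α : ℝ, ((x * α - Λ α : ℝ) : EReal) ≤ c := iSup_le_iff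

/-- The upper bound of the large deviation principle for closed sets. -/
theorem expGrowthSup_isClosed_le
    (hint : ∀ n t, Integrable (fun a => Real.exp (t * a)) (μ n)) (hΛ : HasSCGF μ Λ)
    {m : ℝ} (hm : HasDerivAt Λ m 0) {F : Set ℝ} (hF : IsClosed F) :
    ExpGrowth.expGrowthSup (fun n => μ n F) ≤ -(⨅ x ∈ F, legendreFenchel Λ x) := by
  have hc := hΛ.convexOn hint
  have h0 := hΛ.zero
  have hsupp : ∀ α, m * α ≤ Λ α := fun α => by
    simpa [h0] using add_mul_sub_le_of_convexOn hc hm α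
  -- On the right of `m = Λ' 0` the Chernoff bound is available for `α ≥ 0` only, which costs
  -- nothing: for `α ≤ 0` the tangent at `0` gives `b α - Λ α ≤ (b - m) α ≤ 0`, and `α = 0` does as
  -- well. The left side is symmetric. The closed set is then cut at `m`, and each half is enclosed
  -- in the half-line starting at its point nearest to `m`.
  have key : ∀ b, (∀ S : Set ℝ, S ⊆ Set.Ici b → m ≤ b →
        ExpGrowth.expGrowthSup (fun n => μ n S) ≤ -legendreFenchel Λ b) ∧
      (∀ S : Set ℝ, S ⊆ Set.Iic b → b ≤ m →
        ExpGrowth.expGrowthSup (fun n => μ n S) ≤ -legendreFenchel Λ b) := by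
    intro b
    constructor
    · intro S hS hb
      refine (ExpGrowth.expGrowthSup_monotone fun n => measure_mono hS).trans ?_
      rw [EReal.le_neg, legendreFenchel_le_iff]
      intro α
      rw [EReal.le_neg, ← EReal.coe_neg]
      rcases le_total 0 α with hα | hα
      · exact expGrowthSup_Ici_le hint hΛ hα b
      · refine (expGrowthSup_Ici_le hint hΛ le_rfl b).trans ?_
        rw [EReal.coe_le_coe_iff, h0]
        nlinarith [hsupp α]
    · intro S hS hb
      refine (ExpGrowth.expGrowthSup_monotone fun n => measure_mono hS).trans ?_
      rw [EReal.le_neg, legendreFenchel_le_iff]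
      intro α
      rw [EReal.le_neg, ← EReal.coe_neg]
      rcases le_total α 0 with hα | hα
      · exact expGrowthSup_Iic_le hint hΛ hα b
      · refine (expGrowthSup_Iic_le hint hΛ le_rfl b).trans ?_
        rw [EReal.coe_le_coe_iff, h0]
        nlinarith [hsupp α]
  have hbd : ∀ b ∈ F, -legendreFenchel Λ b ≤ -(⨅ x ∈ F, legendreFenchel Λ x) := fun b hb =>
    EReal.neg_le_neg_iff.2 (iInf₂_le b hb)
  have h1 : ExpGrowth.expGrowthSup (fun n => μ n (F ∩ Set.Ici m)) ≤
      -(⨅ x ∈ F, legendreFenchel Λ x) := by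
    rcases (F ∩ Set.Ici m).eq_empty_or_nonempty with he | hne
    · simp only [he, measure_empty]
      exact (ExpGrowth.expGrowthSup_zero.le).trans bot_le
    · have hbb : BddBelow (F ∩ Set.Ici m) := ⟨m, fun x hx => hx.2⟩
      have hmem := (hF.inter isClosed_Ici).csInf_mem hne hbb
      exact ((key _).1 _ (fun x hx => csInf_le hbb hx) hmem.2).trans (hbd _ hmem.1)
  have h2 : ExpGrowth.expGrowthSup (fun n => μ n (F ∩ Set.Iic m)) ≤
      -(⨅ x ∈ F, legendreFenchel Λ x) := by
    rcases (F ∩ Set.Iic m).eq_empty_or_nonempty with he | hne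
    · simp only [he, measure_empty]
      exact (ExpGrowth.expGrowthSup_zero.le).trans bot_le
    · have hbb : BddAbove (F ∩ Set.Iic m) := ⟨m, fun x hx => hx.2⟩
      have hmem := (hF.inter isClosed_Iic).csSup_mem hne hbb
      exact ((key _).2 _ (fun x hx => le_csSup hbb hx) hmem.2).trans (hbd _ hmem.1)
  refine le_trans ?_ (max_le h1 h2)
  rw [← ExpGrowth.expGrowthSup_add]
  refine ExpGrowth.expGrowthSup_monotone fun n => ?_
  refine (measure_mono fun x hx => ?_).trans (measure_union_le (F ∩ Set.Ici m) (F ∩ Set.Iic m))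
  rcases le_total m x with h | h
  · exact Or.inl ⟨hx, h⟩
  · exact Or.inr ⟨hx, h⟩

/-- Off the ball, `a` lies at least `ε` to one side of `x`, so one of the factors `e^{δ(a - x -
ε)}`, `e^{-δ(a - x + ε)}` is at least `1` and may be inserted under the integral. This isolates the
mass of the ball without introducing a tilted measure. -/
theorem mgf_le_measure_ball_add {ν : Measure ℝ} [IsProbabilityMeasure ν]
    (hint : ∀ t, Integrable (fun a => Real.exp (t * a)) ν) (t x : ℝ) {ε δ : ℝ} (hδ : 0 ≤ δ) :
    mgf id ν t ≤ Real.exp (t * x + |t| * ε) * ν.real (Metric.ball x ε) +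
      (Real.exp (-(δ * (x + ε))) * mgf id ν (t + δ) +
        Real.exp (δ * (x - ε)) * mgf id ν (t - δ)) := by
  have hi : Integrable (Set.indicator (Metric.ball x ε)
      fun _ => Real.exp (t * x + |t| * ε)) ν :=
    (integrable_const _).indicator Metric.isOpen_ball.measurableSet
  have e1 : Real.exp (t * x + |t| * ε) * ν.real (Metric.ball x ε) =
      ∫ a, Set.indicator (Metric.ball x ε) (fun _ => Real.exp (t * x + |t| * ε)) a ∂ν := by
    rw [integral_indicator Metric.isOpen_ball.measurableSet]
    simp [mul_comm]
  have i1 := (hint (t + δ)).const_mul (Real.exp (-(δ * (x + ε))))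
  have i2 := (hint (t - δ)).const_mul (Real.exp (δ * (x - ε)))
  have i3 : Integrable (fun a => Real.exp (-(δ * (x + ε))) * Real.exp ((t + δ) * a) +
      Real.exp (δ * (x - ε)) * Real.exp ((t - δ) * a)) ν := i1.add i2
  simp only [mgf, id]
  rw [e1, ← integral_const_mul, ← integral_const_mul, ← integral_add i1 i2,
    ← integral_add hi i3]
  refine integral_mono (hint t) (hi.add i3) fun a => ?_
  simp only [← Real.exp_add]
  have p1 := Real.exp_pos (-(δ * (x + ε)) + (t + δ) * a)
  have p2 := Real.exp_pos (δ * (x - ε) + (t - δ) * a)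
  by_cases ha : a ∈ Metric.ball x ε
  · rw [Set.indicator_of_mem ha]
    have : Real.exp (t * a) ≤ Real.exp (t * x + |t| * ε) := by
      refine Real.exp_le_exp.2 ?_
      rw [Metric.mem_ball, Real.dist_eq] at ha
      have := le_abs_self (t * (a - x))
      rw [abs_mul] at this
      nlinarith [mul_le_mul_of_nonneg_left ha.le (abs_nonneg t)]
    linarith
  · rw [Set.indicator_of_notMem ha]
    rw [Metric.mem_ball, Real.dist_eq, not_lt, le_abs'] at ha
    rcases ha with ha | ha
    · have : Real.exp (t * a) ≤ Real.exp (δ * (x - ε) + (t - δ) * a) :=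
        Real.exp_le_exp.2 (by nlinarith)
      linarith
    · have : Real.exp (t * a) ≤ Real.exp (-(δ * (x + ε)) + (t + δ) * a) :=
        Real.exp_le_exp.2 (by nlinarith)
      linarith

/-- The lower bound of the large deviation principle at the derivatives of the scaled cumulant
generating function, by exponential tilting. -/
theorem le_expGrowthInf_of_hasDerivAt
    (hint : ∀ n t, Integrable (fun a => Real.exp (t * a)) (μ n)) (hΛ : HasSCGF μ Λ)
    {α x : ℝ} (hx : HasDerivAt Λ x α) {U : Set ℝ} (hU : IsOpen U) (hxU : x ∈ U) :
    ((-(x * α - Λ α) : ℝ) : EReal) ≤ ExpGrowth.expGrowthInf (fun n => μ n U) := by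
  rw [← EReal.ge_of_forall_gt_iff_ge]
  intro z hz
  rw [EReal.coe_lt_coe_iff] at hz
  obtain ⟨ε₀, hε₀, hball⟩ := Metric.isOpen_iff.1 hU x hxU
  -- Replacing `e^{αna}` by its value at `x` on the ball loses at most `e^{|α|nε}`, a quarter of the
  -- available exponent.
  obtain ⟨ε, hε, hεε₀, hεη⟩ : ∃ ε > 0, ε ≤ ε₀ ∧ |α| * ε ≤ (-(x * α - Λ α) - z) / 4 := by
    have h4 : 0 < (-(x * α - Λ α) - z) / 4 := by linarith
    refine ⟨min ε₀ ((-(x * α - Λ α) - z) / 4 / (|α| + 1)), by positivity, min_le_left _ _, ?_⟩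
    refine (mul_le_mul_of_nonneg_left (min_le_right _ _) (abs_nonneg α)).trans ?_
    rw [mul_div_assoc', div_le_iff₀ (by positivity)]
    nlinarith
  -- Differentiability at `α` is used here: both tail terms grow at a rate strictly below `Λ α`.
  obtain ⟨δ, hδ, hplus, hminus⟩ : ∃ δ > 0, Λ (α + δ) < Λ α + δ * (x + ε) ∧
      Λ (α - δ) < Λ α - δ * (x - ε) := by
    have := hx.isLittleO.def (half_pos hε)
    obtain ⟨r, hr, hr'⟩ := Metric.eventually_nhds_iff.1 this
    have a1 := hr' (y := α + r / 2) (by simp [abs_of_pos hr]; linarith)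
    have a2 := hr' (y := α - r / 2) (by simp [abs_of_pos hr]; linarith)
    simp only [add_sub_cancel_left, smul_eq_mul, Real.norm_eq_abs, sub_sub_cancel_left,
      abs_neg, abs_of_pos (half_pos hr)] at a1 a2
    have b1 := (abs_le.1 a1).2
    have b2 := (abs_le.1 a2).2
    have := mul_pos hr hε
    exact ⟨r / 2, half_pos hr, by linarith, by linarith⟩
  -- A quarter of the smallest gap absorbs the errors in the three limits. With `E = n (Λ α - κ)`,
  -- each tail is at most `e^{E - 2κn}`, hence at most `e^E / 4` once `n ≥ ln 4 / κ`, which leaves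
  -- at least `e^E / 2` for the ball.
  obtain ⟨κ, hκ, hκ1, hκ2, hκ3⟩ : ∃ κ > 0, 4 * κ ≤ -(x * α - Λ α) - z ∧
      4 * κ ≤ Λ α + δ * (x + ε) - Λ (α + δ) ∧ 4 * κ ≤ Λ α - δ * (x - ε) - Λ (α - δ) := by
    refine ⟨min (-(x * α - Λ α) - z) (min (Λ α + δ * (x + ε) - Λ (α + δ))
      (Λ α - δ * (x - ε) - Λ (α - δ))) / 4, ?_, ?_, ?_, ?_⟩
    · have : 0 < min (-(x * α - Λ α) - z) (min (Λ α + δ * (x + ε) - Λ (α + δ))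
        (Λ α - δ * (x - ε) - Λ (α - δ))) := lt_min (by linarith) (lt_min (by linarith) (by linarith))
      linarith
    · linarith [min_le_left (-(x * α - Λ α) - z) (min (Λ α + δ * (x + ε) - Λ (α + δ))
        (Λ α - δ * (x - ε) - Λ (α - δ)))]
    · linarith [(min_le_right (-(x * α - Λ α) - z) (min (Λ α + δ * (x + ε) - Λ (α + δ))
        (Λ α - δ * (x - ε) - Λ (α - δ)))).trans (min_le_left _ _)]
    · linarith [(min_le_right (-(x * α - Λ α) - z) (min (Λ α + δ * (x + ε) - Λ (α + δ))
        (Λ α - δ * (x - ε) - Λ (α - δ)))).trans (min_le_right _ _)]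
  apply Eventually.le_expGrowthInf
  have hlarge : ∀ᶠ n : ℕ in atTop, Real.log 4 / κ ≤ n :=
    tendsto_natCast_atTop_atTop.eventually_ge_atTop _
  filter_upwards [(hΛ α).eventually_const_lt (show Λ α - κ < Λ α by linarith),
    (hΛ (α + δ)).eventually_lt_const (show Λ (α + δ) < Λ (α + δ) + κ by linarith),
    (hΛ (α - δ)).eventually_lt_const (show Λ (α - δ) < Λ (α - δ) + κ by linarith),
    eventually_gt_atTop 0, hlarge] with n h1 h2 h3 hn hn4
  have hn' : (0 : ℝ) < n := by exact_mod_cast hn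
  have hmgf : ∀ t, mgf id (μ n) t = Real.exp (cgf id (μ n) t) := fun t =>
    (exp_cgf (hint n t)).symm
  rw [cgf_id_eq, lt_inv_mul_iff₀ hn'] at h1
  rw [cgf_id_eq, inv_mul_lt_iff₀ hn'] at h2 h3
  have main := mgf_le_measure_ball_add (hint n) (α * n) x (ε := ε) (δ := δ * n) (by positivity)
  rw [← add_mul, ← sub_mul, hmgf, hmgf, hmgf, ← Real.exp_add, ← Real.exp_add] at main
  have t1 : Real.exp (-(δ * n * (x + ε)) + cgf id (μ n) ((α + δ) * n)) ≤
      Real.exp (n * (Λ α - κ) - 2 * (κ * n)) := Real.exp_le_exp.2 (by nlinarith)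
  have t2 : Real.exp (δ * n * (x - ε) + cgf id (μ n) ((α - δ) * n)) ≤
      Real.exp (n * (Λ α - κ) - 2 * (κ * n)) := Real.exp_le_exp.2 (by nlinarith)
  have t0 : Real.exp (n * (Λ α - κ)) ≤ Real.exp (cgf id (μ n) (α * n)) :=
    Real.exp_le_exp.2 h1.le
  have t4 : Real.exp (n * (Λ α - κ) - 2 * (κ * n)) * 4 ≤ Real.exp (n * (Λ α - κ)) := by
    have hk : Real.log 4 ≤ κ * n := by rw [div_le_iff₀ hκ] at hn4; linarith
    have h4 : (4 : ℝ) = Real.exp (Real.log 4) := (Real.exp_log (by norm_num)).symm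
    rw [h4, ← Real.exp_add]
    exact Real.exp_le_exp.2 (by nlinarith)
  have t5 : Real.exp (n * (Λ α - κ) - κ * n) * 2 ≤ Real.exp (n * (Λ α - κ)) := by
    have hk : Real.log 4 ≤ κ * n := by rw [div_le_iff₀ hκ] at hn4; linarith
    have h4 : (2 : ℝ) = Real.exp (Real.log 2) := (Real.exp_log (by norm_num)).symm
    rw [h4, ← Real.exp_add]
    have := Real.log_le_log (x := 2) (y := 4) (by norm_num) (by norm_num)
    exact Real.exp_le_exp.2 (by linarith)
  have t6 : Real.exp (n * (Λ α - κ) - κ * n) ≤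
      Real.exp (α * n * x + |α * n| * ε) * (μ n).real (Metric.ball x ε) := by
    linarith
  have t7 : Real.exp (z * n) ≤ (μ n).real (Metric.ball x ε) := by
    have : Real.exp (z * n) * Real.exp (α * n * x + |α * n| * ε) ≤
        Real.exp (n * (Λ α - κ) - κ * n) := by
      rw [← Real.exp_add, abs_mul, abs_of_pos hn']
      refine Real.exp_le_exp.2 ?_
      nlinarith
    have h8 := Real.exp_pos (α * n * x + |α * n| * ε)
    nlinarith
  have : ((z : EReal) * (n : EReal)) = ((z * n : ℝ) : EReal) := by
    rw [EReal.coe_mul]; rfl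
  rw [this, EReal.exp_coe]
  refine (ENNReal.ofReal_le_ofReal t7).trans ?_
  rw [Measure.real, ENNReal.ofReal_toReal (measure_ne_top _ _)]
  exact measure_mono ((Metric.ball_subset_ball hεε₀).trans hball)

end GartnerEllis

/-! ### The Legendre–Fenchel transform of a guesswork scaled cumulant generating function -/

/-- The properties of a scaled cumulant generating function of guesswork that determine the shape
of its Legendre–Fenchel transform. -/
structure IsGuessworkSCGF (Λ : ℝ → ℝ) (h C : ℝ) : Prop where
  convexOn : ConvexOn ℝ Set.univ Λ
  differentiable : Differentiable ℝ Λ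
  zero : Λ 0 = 0
  eq_of_le : ∀ α ≤ -1, Λ α = -h
  le_mul : ∀ α, 0 ≤ α → Λ α ≤ Real.log 2 * α
  mul_sub_le : ∀ α, Real.log 2 * α - C ≤ Λ α

theorem lowerSemicontinuous_legendreFenchel (Λ : ℝ → ℝ) :
    LowerSemicontinuous (legendreFenchel Λ) :=
  lowerSemicontinuous_iSup fun α => Continuous.lowerSemicontinuous
    (continuous_coe_real_ereal.comp (by fun_prop : Continuous fun x : ℝ => x * α - Λ α))

namespace IsGuessworkSCGF

variable {Λ : ℝ → ℝ} {h C : ℝ}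

theorem hasDerivAt_neg_two (H : IsGuessworkSCGF Λ h C) : HasDerivAt Λ 0 (-2) := by
  refine (hasDerivAt_const (-2 : ℝ) (-h)).congr_of_eventuallyEq ?_
  filter_upwards [Iio_mem_nhds (show (-2 : ℝ) < -1 by norm_num)] with α hα
  exact H.eq_of_le α (le_of_lt hα)

theorem neg_le (H : IsGuessworkSCGF Λ h C) (α : ℝ) : -h ≤ Λ α := by
  have := add_mul_sub_le_of_convexOn H.convexOn H.hasDerivAt_neg_two α
  rw [H.eq_of_le (-2) (by norm_num)] at this
  linarith

/-- Darboux's theorem between `-2`, where the slope is `0`, and a far point `b`. A slope at most `y`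
at `b` would give `Λ b ≤ b y` by the tangent evaluated at `0`, against `Λ b ≥ b ln 2 - C`; the
choice of `b` makes `b (ln 2 - y) > C`. -/
theorem exists_hasDerivAt (H : IsGuessworkSCGF Λ h C) {y : ℝ}
    (hy : y ∈ Set.Ioo 0 (Real.log 2)) : ∃ α, HasDerivAt Λ y α := by
  obtain ⟨hy0, hy1⟩ := hy
  set b : ℝ := (|C| + 1) / (Real.log 2 - y) with hb
  have hly : 0 < Real.log 2 - y := by linarith
  have hbpos : 0 < b := by positivity
  have hbC : b * (Real.log 2 - y) = |C| + 1 := by rw [hb]; field_simp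
  have h1 := add_mul_sub_le_of_convexOn H.convexOn (H.differentiable b).hasDerivAt 0
  have h2 := H.mul_sub_le b
  rw [H.zero] at h1
  have h3 : y < deriv Λ b := by
    by_contra hcon
    push Not at hcon
    nlinarith [le_abs_self C, mul_le_mul_of_nonneg_left hcon hbpos.le]
  obtain ⟨α, -, hα⟩ := exists_hasDerivWithinAt_eq_of_gt_of_lt (a := -2) (b := b) (f := Λ)
    (f' := deriv Λ) (by linarith) (fun x _ => (H.differentiable x).hasDerivAt.hasDerivWithinAt)
    (m := y) (by rw [H.hasDerivAt_neg_two.deriv]; exact hy0) h3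
  exact ⟨α, hα ▸ (H.differentiable α).hasDerivAt⟩

theorem legendreFenchel_le (H : IsGuessworkSCGF Λ h C) {x : ℝ}
    (hx : x ∈ Set.Icc 0 (Real.log 2)) : legendreFenchel Λ x ≤ ((max C h : ℝ) : EReal) := by
  rw [legendreFenchel_le_iff]
  intro α
  rw [EReal.coe_le_coe_iff]
  rcases le_total 0 α with hα | hα
  · refine le_trans ?_ (le_max_left _ _)
    nlinarith [H.mul_sub_le α, mul_le_mul_of_nonneg_right hx.2 hα]
  · refine le_trans ?_ (le_max_right _ _)
    nlinarith [H.neg_le α, mul_nonneg hx.1 (neg_nonneg.2 hα)]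

theorem coe_toReal (H : IsGuessworkSCGF Λ h C) {x : ℝ} (hx : x ∈ Set.Icc 0 (Real.log 2)) :
    (((legendreFenchel Λ x).toReal : ℝ) : EReal) = legendreFenchel Λ x := by
  refine EReal.coe_toReal ?_ ?_
  · exact ((H.legendreFenchel_le hx).trans_lt (EReal.coe_lt_top _)).ne
  · exact (lt_of_lt_of_le EReal.bot_lt_zero (legendreFenchel_nonneg H.zero x)).ne'

theorem le_toReal (H : IsGuessworkSCGF Λ h C) {x : ℝ} (hx : x ∈ Set.Icc 0 (Real.log 2)) (α : ℝ) :
    x * α - Λ α ≤ (legendreFenchel Λ x).toReal := by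
  rw [← EReal.coe_le_coe_iff, H.coe_toReal hx]
  exact le_legendreFenchel Λ x α

/-- Equality would make `α` a maximiser of `t ↦ x t - Λ t`, and the vanishing derivative there would
force `x = z`. -/
theorem lt_toReal (H : IsGuessworkSCGF Λ h C) {x : ℝ} (hx : x ∈ Set.Icc 0 (Real.log 2))
    {z α : ℝ} (hα : HasDerivAt Λ z α) (hxz : x ≠ z) :
    x * α - Λ α < (legendreFenchel Λ x).toReal := by
  refine (H.le_toReal hx α).lt_of_ne fun he => hxz ?_
  have hmax : IsLocalMax (fun t => x * t - Λ t) α :=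
    Eventually.of_forall fun t => by
      change x * t - Λ t ≤ x * α - Λ α
      rw [he]; exact H.le_toReal hx t
  have hd : HasDerivAt (fun t => x * t - Λ t) (x * 1 - z) α :=
    ((hasDerivAt_id α).const_mul x).sub hα
  have := hmax.hasDerivAt_eq_zero hd
  linarith

theorem legendreFenchel_eq_of_hasDerivAt (H : IsGuessworkSCGF Λ h C) {z α : ℝ}
    (hα : HasDerivAt Λ z α) : legendreFenchel Λ z = ((z * α - Λ α : ℝ) : EReal) := by
  refine le_antisymm (legendreFenchel_le_iff.2 fun t => ?_) (le_legendreFenchel Λ z α)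
  rw [EReal.coe_le_coe_iff]
  have := add_mul_sub_le_of_convexOn H.convexOn hα t
  linarith

/-- A proper convex combination `z` of two distinct points is interior, hence a slope `Λ' α`. The
affine minorant `x ↦ x α - Λ α` touches the transform at `z` and lies strictly below it elsewhere on
the interval, endpoints included. -/
theorem strictConvexOn (H : IsGuessworkSCGF Λ h C) :
    StrictConvexOn ℝ (Set.Icc 0 (Real.log 2)) fun x => (legendreFenchel Λ x).toReal := by
  refine ⟨convex_Icc _ _, fun x hx y hy hxy a b ha hb hab => ?_⟩
  obtain ⟨z, hz⟩ : ∃ z, z = a • x + b • y := ⟨_, rfl⟩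
  simp only [smul_eq_mul] at hz ⊢
  rw [← hz]
  have ha1 : a = 1 - b := by linarith
  have hb1 : b = 1 - a := by linarith
  have hzx' : z - x = b * (y - x) := by rw [hz, ha1]; ring
  have hzy' : z - y = a * (x - y) := by rw [hz, hb1]; ring
  have hzx : x ≠ z := by
    rintro rfl
    rw [sub_self, zero_eq_mul, sub_eq_zero] at hzx'
    exact hzx'.elim hb.ne' fun h1 => hxy h1.symm
  have hzy : y ≠ z := by
    rintro rfl
    rw [sub_self, zero_eq_mul, sub_eq_zero] at hzy'
    exact hzy'.elim ha.ne' hxy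
  have hz01 : z ∈ Set.Ioo 0 (Real.log 2) := by
    rcases lt_or_gt_of_ne hxy with hlt | hlt
    · have h1 := mul_pos hb (sub_pos.2 hlt)
      have h2 := mul_pos ha (sub_pos.2 hlt)
      exact ⟨by linarith [hx.1], by linarith [hy.2]⟩
    · have h1 := mul_pos hb (sub_pos.2 hlt)
      have h2 := mul_pos ha (sub_pos.2 hlt)
      exact ⟨by linarith [hy.1], by linarith [hx.2]⟩
  obtain ⟨α, hα⟩ := H.exists_hasDerivAt hz01
  rw [H.legendreFenchel_eq_of_hasDerivAt hα, EReal.toReal_coe]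
  have h1 := mul_lt_mul_of_pos_left (H.lt_toReal hx hα hzx) ha
  have h2 := mul_lt_mul_of_pos_left (H.lt_toReal hy hα hzy) hb
  have h3 : z * α - Λ α = a * (x * α - Λ α) + b * (y * α - Λ α) := by
    rw [hz, hb1]; ring
  linarith

theorem legendreFenchel_eq_top (H : IsGuessworkSCGF Λ h C) {x : ℝ}
    (hx : x ∉ Set.Icc 0 (Real.log 2)) : legendreFenchel Λ x = ⊤ := by
  rw [EReal.eq_top_iff_forall_lt]
  intro y
  rcases lt_or_ge x 0 with hx0 | hx0
  · obtain ⟨t, ht1, ht⟩ : ∃ t : ℝ, t ≤ -1 ∧ y < x * t + h := by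
      refine ⟨min (-1) ((y - h + 1) / x), min_le_left _ _, ?_⟩
      have := mul_le_mul_of_nonpos_left (min_le_right (-1) ((y - h + 1) / x)) hx0.le
      rw [mul_div_cancel₀ _ hx0.ne] at this
      linarith
    refine lt_of_lt_of_le ?_ (le_legendreFenchel Λ x t)
    rw [EReal.coe_lt_coe_iff, H.eq_of_le t ht1]
    linarith
  · have hxl : 0 < x - Real.log 2 := by
      by_contra hcon
      exact hx ⟨hx0, by linarith⟩
    obtain ⟨t, ht1, ht⟩ : ∃ t : ℝ, 0 ≤ t ∧ y < (x - Real.log 2) * t := by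
      refine ⟨max 0 ((y + 1) / (x - Real.log 2)), le_max_left _ _, ?_⟩
      have := mul_le_mul_of_nonneg_left (le_max_right 0 ((y + 1) / (x - Real.log 2))) hxl.le
      rw [mul_div_cancel₀ _ hxl.ne'] at this
      linarith
    refine lt_of_lt_of_le ?_ (le_legendreFenchel Λ x t)
    rw [EReal.coe_lt_coe_iff]
    linarith [H.le_mul t ht1]

theorem isGuessworkRateFunction (H : IsGuessworkSCGF Λ h C) {m : ℝ} (hm : HasDerivAt Λ m 0) :
    IsGuessworkRateFunction (legendreFenchel Λ) h m where
  lowerSemicontinuous := lowerSemicontinuous_legendreFenchel Λ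
  nonneg := legendreFenchel_nonneg H.zero
  finite x hx := (H.legendreFenchel_le hx).trans_lt (EReal.coe_lt_top _)
  top_of_notMem x hx := H.legendreFenchel_eq_top hx
  convex := H.strictConvexOn.convexOn
  at_zero := by
    refine le_antisymm (legendreFenchel_le_iff.2 fun t => ?_) ?_
    · rw [EReal.coe_le_coe_iff]
      linarith [H.neg_le t]
    · have := le_legendreFenchel Λ 0 (-1)
      rwa [H.eq_of_le (-1) le_rfl, zero_mul, zero_sub, neg_neg] at this
  eq_zero_iff x := by
    constructor
    · intro hx
      by_contra hne
      have hmem : x ∈ Set.Icc 0 (Real.log 2) := by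
        by_contra hcon
        rw [H.legendreFenchel_eq_top hcon] at hx
        exact EReal.top_ne_zero hx
      have := H.lt_toReal hmem hm hne
      rw [hx, H.zero] at this
      simp at this
    · rintro rfl
      rw [H.legendreFenchel_eq_of_hasDerivAt hm, H.zero]
      simp
  strictConvex := H.strictConvexOn

variable {μ : ℕ → Measure ℝ} [∀ n, IsProbabilityMeasure (μ n)]

theorem satisfiesLDP (H : IsGuessworkSCGF Λ h C)
    (hint : ∀ n t, Integrable (fun a => Real.exp (t * a)) (μ n)) (hΛ : HasSCGF μ Λ) :
    SatisfiesLDP μ (legendreFenchel Λ) := by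
  refine ⟨fun U hU => ?_, fun F hF =>
    expGrowthSup_isClosed_le hint hΛ (H.differentiable 0).hasDerivAt hF⟩
  rw [EReal.neg_le]
  refine le_iInf₂ fun x hxU => ?_
  rw [EReal.neg_le]
  by_cases hx : x ∈ Set.Icc 0 (Real.log 2)
  swap
  · simp [H.legendreFenchel_eq_top hx]
  have hl2 : 0 < Real.log 2 := Real.log_pos (by norm_num)
  -- The endpoints `0` and `ln 2` need not be usable slopes, so `x` is moved slightly towards the
  -- midpoint `w`. Convexity bounds the rate at the moved point by `(1 - t) J x + t J w`, and `t →
  -- 0⁺`.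
  set J : ℝ → ℝ := fun x => (legendreFenchel Λ x).toReal with hJ
  set w := Real.log 2 / 2 with hw
  have hwm : w ∈ Set.Icc 0 (Real.log 2) := ⟨by positivity, by linarith⟩
  rw [← H.coe_toReal hx, ← EReal.coe_neg]
  have hcont : Tendsto (fun t : ℝ => ((-((1 - t) * J x + t * J w) : ℝ) : EReal)) (𝓝[>] 0)
      (𝓝 ((-J x : ℝ) : EReal)) := by
    refine (continuous_coe_real_ereal.tendsto _).comp ?_
    have : Continuous fun t : ℝ => -((1 - t) * J x + t * J w) := by fun_prop
    simpa using (this.tendsto 0).mono_left nhdsWithin_le_nhds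
  refine le_of_tendsto hcont ?_
  have hyU : ∀ᶠ t : ℝ in 𝓝[>] 0, (1 - t) * x + t * w ∈ U := by
    have hcy : Continuous fun t : ℝ => (1 - t) * x + t * w := by fun_prop
    have : Tendsto (fun t : ℝ => (1 - t) * x + t * w) (𝓝[>] 0) (𝓝 x) := by
      simpa using (hcy.tendsto 0).mono_left nhdsWithin_le_nhds
    exact this.eventually (hU.mem_nhds hxU)
  filter_upwards [hyU, Ioo_mem_nhdsGT (zero_lt_one' ℝ)] with t htU ht
  have hy : (1 - t) * x + t * w ∈ Set.Ioo 0 (Real.log 2) := by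
    constructor
    · nlinarith [hx.1, ht.1, ht.2, mul_pos ht.1 hl2, mul_nonneg (sub_nonneg.2 ht.2.le) hx.1]
    · nlinarith [hx.2, ht.1, ht.2, mul_pos ht.1 hl2,
        mul_le_mul_of_nonneg_left hx.2 (sub_nonneg.2 ht.2.le)]
  obtain ⟨α, hα⟩ := H.exists_hasDerivAt hy
  refine le_trans ?_ (le_expGrowthInf_of_hasDerivAt hint hΛ hα hU htU)
  rw [EReal.coe_le_coe_iff]
  have h1 := H.le_toReal (Set.Ioo_subset_Icc_self hy) α
  have h2 := H.strictConvexOn.convexOn.2 hx hwm (sub_nonneg.2 ht.2.le) ht.1.le (by ring)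
  simp only [smul_eq_mul] at h2
  exact neg_le_neg (h1.trans h2)

end IsGuessworkSCGF

/-! ### Optimal guessing functions -/

/-- Needed so that `isGuessworkSCGF` can read properties of the limit off the moments of an actual
guessing function. -/
theorem exists_isOptimalGuessing {n : ℕ} (p : BitString n → ℝ) :
    ∃ G : BitString n → ℕ, IsOptimalGuessing p G := by
  have hcard : Fintype.card (BitString n) = 2 ^ n := by simp [BitString, ZMod.card]
  let e : BitString n ≃ Fin (2 ^ n) := Fintype.equivFinOfCardEq hcard
  let f : Fin (2 ^ n) → ℝ := fun j => -p (e.symm j)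
  let σ := Tuple.sort f
  have hmono : Monotone (f ∘ σ) := Tuple.monotone_sort f
  refine ⟨fun x => (σ.symm (e x) : ℕ) + 1, ⟨fun x _ => ?_, fun x _ y _ hxy => ?_,
    fun j hj => ?_⟩, fun x y hxy => ?_⟩
  · have := (σ.symm (e x)).2
    exact ⟨Nat.le_add_left _ _, this⟩
  · have : σ.symm (e x) = σ.symm (e y) := Fin.ext (by simpa using hxy)
    exact e.injective (σ.symm.injective this)
  · refine ⟨e.symm (σ ⟨j - 1, ?_⟩), trivial, ?_⟩
    · have := hj.1; have := hj.2; omega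
    · have := hj.1
      simp only [Equiv.apply_symm_apply, Equiv.symm_apply_apply]
      omega
  · by_contra hcon
    have hle : σ.symm (e y) ≤ σ.symm (e x) := by
      rw [Fin.le_def]; exact Nat.le_of_succ_le_succ (not_lt.1 hcon)
    have := hmono hle
    simp only [Function.comp_apply, Equiv.apply_symm_apply, Equiv.symm_apply_apply, f] at this
    linarith

namespace IsOptimalGuessing

variable {n : ℕ} {p : BitString n → ℝ} {G : BitString n → ℕ}

theorem one_le (hG : IsOptimalGuessing p G) (x : BitString n) : 1 ≤ G x :=
  (hG.1.mapsTo (Set.mem_univ x)).1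

theorem le_two_pow (hG : IsOptimalGuessing p G) (x : BitString n) : G x ≤ 2 ^ n :=
  (hG.1.mapsTo (Set.mem_univ x)).2

theorem cast_pos (hG : IsOptimalGuessing p G) (x : BitString n) : (0 : ℝ) < G x :=
  Nat.cast_pos.2 (hG.one_le x)

theorem one_le_cast (hG : IsOptimalGuessing p G) (x : BitString n) : (1 : ℝ) ≤ G x :=
  Nat.one_le_cast.2 (hG.one_le x)

theorem cast_le_two_pow (hG : IsOptimalGuessing p G) (x : BitString n) : (G x : ℝ) ≤ 2 ^ n := by
  exact_mod_cast hG.le_two_pow x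

/-- Bijectivity makes this a harmonic sum. Its logarithm is `o(n)`, and it is the only loss in the
moment bounds. -/
theorem sum_inv_le (hG : IsOptimalGuessing p G) :
    ∑ x, (G x : ℝ)⁻¹ ≤ 1 + n * Real.log 2 := by
  have h1 : ∑ x, (G x : ℝ)⁻¹ = ∑ j ∈ Finset.Icc (1 : ℕ) (2 ^ n), (j : ℝ)⁻¹ := by
    refine Finset.sum_nbij G (fun x _ => ?_) ?_ ?_ (fun x _ => rfl)
    · exact Finset.mem_Icc.2 ⟨hG.one_le x, hG.le_two_pow x⟩
    · simpa using hG.1.injOn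
    · simpa using hG.1.surjOn
  rw [h1]
  have h2 := harmonic_le_one_add_log (2 ^ n)
  rw [harmonic_eq_sum_Icc] at h2
  push_cast at h2
  rwa [Real.log_pow] at h2

/-- `G x` counts words guessed no later than `x`; each is at least as likely, so it contributes at
least `1` to `∑ (p y / p x) ^ s`. -/
theorem le_sum_rpow (hG : IsOptimalGuessing p G) (hp : ∀ x, 0 < p x) {s : ℝ} (hs : 0 ≤ s)
    (x : BitString n) : (G x : ℝ) ≤ (∑ y, p y ^ s) / p x ^ s := by
  have hcard : G x ≤ (Finset.univ.filter fun y => G y ≤ G x).card := by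
    have : Finset.Icc 1 (G x) ⊆ (Finset.univ.filter fun y => G y ≤ G x).image G := by
      intro j hj
      rw [Finset.mem_Icc] at hj
      obtain ⟨y, -, rfl⟩ := hG.1.surjOn (show j ∈ Set.Icc 1 (2 ^ n) from
        ⟨hj.1, hj.2.trans (hG.le_two_pow x)⟩)
      exact Finset.mem_image_of_mem _ (by simpa using hj.2)
    calc G x = (Finset.Icc 1 (G x)).card := by simp
      _ ≤ _ := (Finset.card_le_card this).trans Finset.card_image_le
  rw [le_div_iff₀ (Real.rpow_pos_of_pos (hp x) s)]
  calc (G x : ℝ) * p x ^ s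
      ≤ ((Finset.univ.filter fun y => G y ≤ G x).card : ℝ) * p x ^ s := by
        refine mul_le_mul_of_nonneg_right ?_ (Real.rpow_nonneg (hp x).le s)
        exact_mod_cast hcard
    _ = ∑ y ∈ Finset.univ.filter fun y => G y ≤ G x, p x ^ s := by simp
    _ ≤ ∑ y ∈ Finset.univ.filter fun y => G y ≤ G x, p y ^ s := by
        refine Finset.sum_le_sum fun y hy => Real.rpow_le_rpow (hp x).le ?_ hs
        by_contra hcon
        have h1 := hG.2 x y (not_le.1 hcon)
        have h2 := (Finset.mem_filter.1 hy).2
        omega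
    _ ≤ ∑ y, p y ^ s := Finset.sum_le_sum_of_subset_of_nonneg (Finset.subset_univ _)
        fun y _ _ => Real.rpow_nonneg (hp y).le s

/-! ### Arikan's bounds for the moments of guesswork -/

theorem sum_rpow_pos (hp : ∀ x, 0 < p x) (s : ℝ) : 0 < ∑ x, p x ^ s :=
  Finset.sum_pos (fun x _ => Real.rpow_pos_of_pos (hp x) s) Finset.univ_nonempty

theorem moment_pos (hG : IsOptimalGuessing p G) (hp : ∀ x, 0 < p x) (α : ℝ) :
    0 < ∑ x, p x * (G x : ℝ) ^ α :=
  Finset.sum_pos (fun x _ => mul_pos (hp x) (Real.rpow_pos_of_pos (hG.cast_pos x) α))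
    Finset.univ_nonempty

/-- The exponent `s = 1/(1+α)` is the one with `1 - s α = s`, so that `le_sum_rpow` yields a pure
power sum. -/
theorem rpow_sum_eq (hp : ∀ x, 0 < p x) {α : ℝ} (hα : -1 < α) :
    ∑ x, p x * ((∑ y, p y ^ (1 + α)⁻¹) / p x ^ (1 + α)⁻¹) ^ α =
      (∑ x, p x ^ (1 + α)⁻¹) ^ (1 + α) := by
  have hα' : 1 + α ≠ 0 := by linarith
  have hP := sum_rpow_pos hp (1 + α)⁻¹
  have : ∀ x, p x * ((∑ y, p y ^ (1 + α)⁻¹) / p x ^ (1 + α)⁻¹) ^ α =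
      p x ^ (1 + α)⁻¹ * (∑ y, p y ^ (1 + α)⁻¹) ^ α := by
    intro x
    rw [Real.div_rpow hP.le (Real.rpow_nonneg (hp x).le _), ← Real.rpow_mul (hp x).le,
      div_eq_mul_inv, ← Real.rpow_neg (hp x).le, mul_comm (_ ^ α), ← mul_assoc]
    congr 1
    nth_rewrite 1 [← Real.rpow_one (p x)]
    rw [← Real.rpow_add (hp x)]
    congr 1
    field_simp
    ring
  simp_rw [this]
  rw [← Finset.sum_mul, Real.rpow_add hP, Real.rpow_one]

theorem moment_le_of_nonneg (hG : IsOptimalGuessing p G) (hp : ∀ x, 0 < p x) {α : ℝ}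
    (hα : 0 ≤ α) :
    ∑ x, p x * (G x : ℝ) ^ α ≤ (∑ x, p x ^ (1 + α)⁻¹) ^ (1 + α) := by
  rw [← rpow_sum_eq hp (by linarith)]
  refine Finset.sum_le_sum fun x _ => mul_le_mul_of_nonneg_left ?_ (hp x).le
  exact Real.rpow_le_rpow (hG.cast_pos x).le
    (hG.le_sum_rpow hp (inv_nonneg.2 (by linarith)) x) hα

theorem le_moment_of_nonpos (hG : IsOptimalGuessing p G) (hp : ∀ x, 0 < p x) {α : ℝ}
    (hα : -1 < α) (hα0 : α ≤ 0) :
    (∑ x, p x ^ (1 + α)⁻¹) ^ (1 + α) ≤ ∑ x, p x * (G x : ℝ) ^ α := by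
  rw [← rpow_sum_eq hp hα]
  refine Finset.sum_le_sum fun x _ => mul_le_mul_of_nonneg_left ?_ (hp x).le
  exact Real.rpow_le_rpow_of_nonpos (hG.cast_pos x)
    (hG.le_sum_rpow hp (inv_nonneg.2 (by linarith)) x) hα0

theorem le_moment_mul_of_pos (hG : IsOptimalGuessing p G) (hp : ∀ x, 0 < p x) {α : ℝ}
    (hα : 0 < α) :
    (∑ x, p x ^ (1 + α)⁻¹) ^ (1 + α) ≤
      (∑ x, p x * (G x : ℝ) ^ α) * (∑ x, (G x : ℝ)⁻¹) ^ α := by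
  have h1α : (0 : ℝ) < 1 + α := by linarith
  -- Hölder for `p^{1/(1+α)} = (p G^α)^{1/(1+α)} · G^{-α/(1+α)}`; the conjugate exponent turns the
  -- second factor into `1/G`.
  have hconj : (1 + α).HolderConjugate ((1 + α) / α) := by
    rw [Real.holderConjugate_iff]
    refine ⟨by linarith, ?_⟩
    field_simp
  have hE := hG.moment_pos hp α
  have hH : 0 ≤ ∑ x, (G x : ℝ)⁻¹ :=
    Finset.sum_nonneg fun x _ => inv_nonneg.2 (hG.cast_pos x).le
  have key := Real.inner_le_Lp_mul_Lq_of_nonneg Finset.univ hconj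
    (f := fun x => (p x * (G x : ℝ) ^ α) ^ (1 + α)⁻¹)
    (g := fun x => (G x : ℝ) ^ (-(α * (1 + α)⁻¹)))
    (fun x _ => Real.rpow_nonneg (mul_nonneg (hp x).le (Real.rpow_nonneg (hG.cast_pos x).le _)) _)
    (fun x _ => Real.rpow_nonneg (hG.cast_pos x).le _)
  have e1 : ∀ x, (p x * (G x : ℝ) ^ α) ^ (1 + α)⁻¹ * (G x : ℝ) ^ (-(α * (1 + α)⁻¹)) =
      p x ^ (1 + α)⁻¹ := by
    intro x
    have hg := hG.cast_pos x
    rw [Real.mul_rpow (hp x).le (Real.rpow_nonneg hg.le _), ← Real.rpow_mul hg.le, mul_assoc,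
      ← Real.rpow_add hg]
    simp
  have e2 : ∀ x, ((p x * (G x : ℝ) ^ α) ^ (1 + α)⁻¹) ^ (1 + α) = p x * (G x : ℝ) ^ α := by
    intro x
    have hg := hG.cast_pos x
    rw [← Real.rpow_mul (mul_nonneg (hp x).le (Real.rpow_nonneg hg.le _)),
      inv_mul_cancel₀ h1α.ne', Real.rpow_one]
  have e3 : ∀ x, ((G x : ℝ) ^ (-(α * (1 + α)⁻¹))) ^ ((1 + α) / α) = (G x : ℝ)⁻¹ := by
    intro x
    have hg := hG.cast_pos x
    have he : -(α * (1 + α)⁻¹) * ((1 + α) / α) = -1 := by field_simp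
    rw [← Real.rpow_mul hg.le, he, Real.rpow_neg_one]
  simp_rw [e1, e2, e3] at key
  have key2 := Real.rpow_le_rpow (sum_rpow_pos hp _).le key h1α.le
  rw [Real.mul_rpow (Real.rpow_nonneg hE.le _) (Real.rpow_nonneg hH _), ← Real.rpow_mul hE.le,
    ← Real.rpow_mul hH, one_div_mul_cancel h1α.ne', Real.rpow_one] at key2
  have : 1 / ((1 + α) / α) * (1 + α) = α := by field_simp
  rwa [this] at key2

theorem moment_le_mul_of_neg (hG : IsOptimalGuessing p G) (hp : ∀ x, 0 < p x) {α : ℝ}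
    (hα : -1 < α) (hα0 : α < 0) :
    ∑ x, p x * (G x : ℝ) ^ α ≤
      (∑ x, p x ^ (1 + α)⁻¹) ^ (1 + α) * (∑ x, (G x : ℝ)⁻¹) ^ (-α) := by
  have h1α : (0 : ℝ) < 1 + α := by linarith
  -- Hölder applied directly to `p · G^α`; the second exponent again produces `1/G`.
  have hconj : (1 + α)⁻¹.HolderConjugate (-α)⁻¹ := by
    rw [Real.holderConjugate_iff]
    refine ⟨(one_lt_inv₀ h1α).2 (by linarith), ?_⟩
    rw [inv_inv, inv_inv]; ring
  have key := Real.inner_le_Lp_mul_Lq_of_nonneg Finset.univ hconj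
    (f := p) (g := fun x => (G x : ℝ) ^ α) (fun x _ => (hp x).le)
    (fun x _ => Real.rpow_nonneg (hG.cast_pos x).le _)
  have e3 : ∀ x, ((G x : ℝ) ^ α) ^ (-α)⁻¹ = (G x : ℝ)⁻¹ := by
    intro x
    have he : α * (-α)⁻¹ = -1 := by rw [inv_neg, mul_neg, mul_inv_cancel₀ hα0.ne]
    rw [← Real.rpow_mul (hG.cast_pos x).le, he, Real.rpow_neg_one]
  simp_rw [e3, one_div, inv_inv] at key
  exact key

theorem abs_log_moment_sub_le (hG : IsOptimalGuessing p G) (hp : ∀ x, 0 < p x) {α : ℝ}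
    (hα : -1 < α) :
    |Real.log (∑ x, p x * (G x : ℝ) ^ α) - (1 + α) * Real.log (∑ x, p x ^ (1 + α)⁻¹)| ≤
      |α| * Real.log (1 + n * Real.log 2) := by
  have hE := hG.moment_pos hp α
  have hP := sum_rpow_pos hp (1 + α)⁻¹
  have hPα := Real.rpow_pos_of_pos hP (1 + α)
  have hl2 : 0 ≤ n * Real.log 2 := mul_nonneg (Nat.cast_nonneg n) (Real.log_nonneg (by norm_num))
  have hH0 : 0 < ∑ x, (G x : ℝ)⁻¹ :=
    Finset.sum_pos (fun x _ => inv_pos.2 (hG.cast_pos x)) Finset.univ_nonempty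
  have hH : Real.log (∑ x, (G x : ℝ)⁻¹) ≤ Real.log (1 + n * Real.log 2) :=
    Real.log_le_log hH0 hG.sum_inv_le
  have hlog : 0 ≤ Real.log (1 + n * Real.log 2) := Real.log_nonneg (by linarith)
  rw [← Real.log_rpow hP]
  rcases lt_trichotomy α 0 with hα0 | rfl | hα0
  · have h1 := Real.log_le_log hPα (hG.le_moment_of_nonpos hp hα hα0.le)
    have h2 := Real.log_le_log hE (hG.moment_le_mul_of_neg hp hα hα0)
    rw [Real.log_mul hPα.ne' (Real.rpow_pos_of_pos hH0 _).ne', Real.log_rpow hH0] at h2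
    rw [abs_of_neg hα0, abs_of_nonneg (by linarith)]
    nlinarith
  · simp
  · have h1 := Real.log_le_log hE (hG.moment_le_of_nonneg hp hα0.le)
    have h2 := Real.log_le_log hPα (hG.le_moment_mul_of_pos hp hα0)
    rw [Real.log_mul hE.ne' (Real.rpow_pos_of_pos hH0 _).ne', Real.log_rpow hH0] at h2
    rw [abs_of_pos hα0, abs_of_nonpos (by linarith)]
    nlinarith

/-- The first guess alone contributes `p 0`; conversely `G^α ≤ 1/G` leaves `p 0` times the harmonic
sum. -/
theorem abs_log_moment_sub_le_of_le_neg_one (hG : IsOptimalGuessing p G) (hp : ∀ x, 0 < p x)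
    (hmax : ∀ x, p x ≤ p 0) {α : ℝ} (hα : α ≤ -1) :
    |Real.log (∑ x, p x * (G x : ℝ) ^ α) - Real.log (p 0)| ≤ Real.log (1 + n * Real.log 2) := by
  have hE := hG.moment_pos hp α
  have hH0 : 0 < ∑ x, (G x : ℝ)⁻¹ :=
    Finset.sum_pos (fun x _ => inv_pos.2 (hG.cast_pos x)) Finset.univ_nonempty
  have hH : Real.log (∑ x, (G x : ℝ)⁻¹) ≤ Real.log (1 + n * Real.log 2) :=
    Real.log_le_log hH0 hG.sum_inv_le
  have lower : p 0 ≤ ∑ x, p x * (G x : ℝ) ^ α := by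
    obtain ⟨x, -, hx⟩ := hG.1.surjOn (show 1 ∈ Set.Icc 1 (2 ^ n) from ⟨le_rfl, Nat.one_le_two_pow⟩)
    have h0x : p 0 ≤ p x := by
      by_contra hcon
      have h1 := hG.2 0 x (not_le.1 hcon)
      have h2 := hG.one_le 0
      omega
    calc p 0 ≤ p x * (G x : ℝ) ^ α := by simpa [hx] using h0x
      _ ≤ _ := Finset.single_le_sum (f := fun x => p x * (G x : ℝ) ^ α)
          (fun y _ => mul_nonneg (hp y).le (Real.rpow_nonneg (hG.cast_pos y).le _))
          (Finset.mem_univ x)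
  have upper : ∑ x, p x * (G x : ℝ) ^ α ≤ p 0 * ∑ x, (G x : ℝ)⁻¹ := by
    rw [Finset.mul_sum]
    refine Finset.sum_le_sum fun x _ => mul_le_mul (hmax x) ?_
      (Real.rpow_nonneg (hG.cast_pos x).le _) (hp 0).le
    rw [← Real.rpow_neg_one]
    exact Real.rpow_le_rpow_of_exponent_le (hG.one_le_cast x) hα
  have h1 := Real.log_le_log (hp 0) lower
  have h2 := Real.log_le_log hE upper
  rw [Real.log_mul (hp 0).ne' hH0.ne'] at h2
  rw [abs_of_nonneg (by linarith)]
  linarith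

theorem moment_le (hG : IsOptimalGuessing p G) (hp : ∀ x, 0 < p x) (hsum : ∑ x, p x = 1)
    {α : ℝ} (hα : 0 ≤ α) : Real.log (∑ x, p x * (G x : ℝ) ^ α) ≤ n * (Real.log 2 * α) := by
  have : ∑ x, p x * (G x : ℝ) ^ α ≤ ((2 : ℝ) ^ n) ^ α := by
    calc ∑ x, p x * (G x : ℝ) ^ α ≤ ∑ x, p x * ((2 : ℝ) ^ n) ^ α :=
          Finset.sum_le_sum fun x _ => mul_le_mul_of_nonneg_left
            (Real.rpow_le_rpow (hG.cast_pos x).le (hG.cast_le_two_pow x) hα) (hp x).le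
      _ = _ := by rw [← Finset.sum_mul, hsum, one_mul]
  refine (Real.log_le_log (hG.moment_pos hp α) this).trans_eq ?_
  rw [Real.log_rpow (by positivity), Real.log_pow]
  ring

theorem le_moment (hG : IsOptimalGuessing p G) (hp : ∀ x, 0 < p x) {C : ℝ}
    (hC : ∀ x, Real.exp (-(C * n)) ≤ p x) (α : ℝ) :
    n * (Real.log 2 * α - C) ≤ Real.log (∑ x, p x * (G x : ℝ) ^ α) := by
  -- Only the last word guessed is kept.
  obtain ⟨x, -, hx⟩ := hG.1.surjOn (show 2 ^ n ∈ Set.Icc 1 (2 ^ n) from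
    ⟨Nat.one_le_two_pow, le_rfl⟩)
  have h2 : (0 : ℝ) < (2 ^ n) ^ α := by positivity
  have : Real.exp (-(C * n)) * ((2 : ℝ) ^ n) ^ α ≤ ∑ x, p x * (G x : ℝ) ^ α := by
    calc Real.exp (-(C * n)) * ((2 : ℝ) ^ n) ^ α ≤ p x * (G x : ℝ) ^ α := by
          rw [hx]
          push_cast
          exact mul_le_mul_of_nonneg_right (hC x) h2.le
      _ ≤ _ := Finset.single_le_sum (f := fun x => p x * (G x : ℝ) ^ α)
          (fun y _ => mul_nonneg (hp y).le (Real.rpow_nonneg (hG.cast_pos y).le _))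
          (Finset.mem_univ x)
  refine le_trans (le_of_eq ?_) (Real.log_le_log (by positivity) this)
  rw [Real.log_mul (Real.exp_pos _).ne' h2.ne', Real.log_exp, Real.log_rpow (by positivity),
    Real.log_pow]
  ring

end IsOptimalGuessing

/-! ### The law of guesswork -/

section Law

variable {n : ℕ} {p : BitString n → ℝ}

theorem integrable_guessworkLaw (p : BitString n → ℝ) (G : BitString n → ℕ) (f : ℝ → ℝ) :
    Integrable f (guessworkLaw p G) := by
  rw [guessworkLaw, integrable_finsetSum_measure]
  intro x _
  exact (integrable_dirac (by simp)).smul_measure ENNReal.ofReal_ne_top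

theorem integral_guessworkLaw (hp : ∀ x, 0 ≤ p x) (G : BitString n → ℕ) (f : ℝ → ℝ) :
    ∫ a, f a ∂(guessworkLaw p G) = ∑ x, p x * f ((n : ℝ)⁻¹ * Real.log (G x)) := by
  rw [guessworkLaw, integral_finsetSum_measure fun x _ =>
    (integrable_dirac (by simp)).smul_measure ENNReal.ofReal_ne_top]
  refine Finset.sum_congr rfl fun x _ => ?_
  rw [integral_smul_measure, integral_dirac, ENNReal.toReal_ofReal (hp x), smul_eq_mul]

theorem isProbabilityMeasure_guessworkLaw (hp : ∀ x, 0 ≤ p x) (hsum : ∑ x, p x = 1)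
    (G : BitString n → ℕ) : IsProbabilityMeasure (guessworkLaw p G) := by
  constructor
  simp only [guessworkLaw, Measure.coe_finsetSum, Finset.sum_apply, Measure.smul_apply,
    measure_univ, smul_eq_mul, mul_one]
  rw [← ENNReal.ofReal_sum_of_nonneg fun x _ => hp x, hsum, ENNReal.ofReal_one]

theorem integral_exp_guessworkLaw (hp : ∀ x, 0 ≤ p x) {G : BitString n → ℕ}
    (hG : IsOptimalGuessing p G) (hn : n ≠ 0) (α : ℝ) :
    ∫ a, Real.exp (α * n * a) ∂(guessworkLaw p G) = ∑ x, p x * (G x : ℝ) ^ α := by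
  rw [integral_guessworkLaw hp]
  refine Finset.sum_congr rfl fun x _ => ?_
  rw [Real.rpow_def_of_pos (hG.cast_pos x)]
  have : (n : ℝ) ≠ 0 := by exact_mod_cast hn
  congr 2
  field_simp

end Law

/-! ### Guesswork of sources with differentiable power-sum rates -/

/-- The PMFs `p n` are positive and maximal at `0`, their minima decay at most exponentially, and
the rates `T s` of the power sums of `p n / p n 0` exist, are differentiable in `s`, and vanish as
`s → ∞`. -/
structure HasPowerSumRates (p : ∀ n, BitString n → ℝ) (T : ℝ → ℝ) (C : ℝ) : Prop where
  pos : ∀ n x, 0 < p n x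
  sum_eq_one : ∀ n, ∑ x, p n x = 1
  le_zero : ∀ n x, p n x ≤ p n 0
  exp_le : ∀ (n : ℕ) x, Real.exp (-(C * n)) ≤ p n x
  tendsto : ∀ s, 0 < s →
    Tendsto (fun n : ℕ => (n : ℝ)⁻¹ * Real.log (∑ x, (p n x / p n 0) ^ s)) atTop (𝓝 (T s))
  differentiableAt : ∀ s, 0 < s → DifferentiableAt ℝ T s
  tendsto_zero : Tendsto T atTop (𝓝 0)

/-- The scaled cumulant generating function of guesswork in terms of the power-sum rates. -/
noncomputable def guessworkSCGF (T : ℝ → ℝ) (α : ℝ) : ℝ :=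
  if α ≤ -1 then -T 1 else (1 + α) * T (1 + α)⁻¹ - T 1

theorem tendsto_inv_mul_log_one_add {c : ℝ} (hc : 0 < c) :
    Tendsto (fun n : ℕ => (n : ℝ)⁻¹ * Real.log (1 + n * c)) atTop (𝓝 0) := by
  have h1 : Tendsto (fun n : ℕ => 1 + (n : ℝ) * c) atTop atTop :=
    tendsto_atTop_add_const_left _ _ (tendsto_natCast_atTop_atTop.atTop_mul_const hc)
  have h2 : Tendsto (fun n : ℕ => Real.log (1 + n * c) / (1 + n * c)) atTop (𝓝 0) :=
    (Real.isLittleO_log_id_atTop.tendsto_div_nhds_zero).comp h1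
  have h3 : Tendsto (fun n : ℕ => (n : ℝ)⁻¹ + c) atTop (𝓝 (0 + c)) :=
    tendsto_inv_atTop_nhds_zero_nat.add_const _
  have h4 := h2.mul h3
  rw [zero_mul] at h4
  refine h4.congr' ?_
  filter_upwards [eventually_gt_atTop 0] with n hn
  have hn' : (0 : ℝ) < n := by exact_mod_cast hn
  field_simp

theorem tendsto_inv_mul_of_abs_sub_le {u v : ℕ → ℝ} {c l : ℝ}
    (hu : Tendsto (fun n : ℕ => (n : ℝ)⁻¹ * u n) atTop (𝓝 l))
    (h : ∀ n, |v n - u n| ≤ c * Real.log (1 + n * Real.log 2)) :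
    Tendsto (fun n : ℕ => (n : ℝ)⁻¹ * v n) atTop (𝓝 l) := by
  have h0 : Tendsto (fun n : ℕ => (n : ℝ)⁻¹ * (v n - u n)) atTop (𝓝 0) := by
    have h1 := (tendsto_inv_mul_log_one_add (Real.log_pos one_lt_two)).const_mul c
    rw [mul_zero] at h1
    refine squeeze_zero_norm (fun n => ?_) h1
    rw [norm_mul, Real.norm_eq_abs, Real.norm_eq_abs, abs_of_nonneg (by positivity)]
    have := mul_le_mul_of_nonneg_left (h n) (show (0 : ℝ) ≤ (n : ℝ)⁻¹ by positivity)
    linarith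
  have := hu.add h0
  rw [add_zero] at this
  refine this.congr fun n => ?_
  ring

namespace HasPowerSumRates

variable {p : ∀ n, BitString n → ℝ} {T : ℝ → ℝ} {C : ℝ}

theorem log_sum_rpow (H : HasPowerSumRates p T C) (n : ℕ) (s : ℝ) :
    Real.log (∑ x, p n x ^ s) =
      Real.log (∑ x, (p n x / p n 0) ^ s) + s * Real.log (p n 0) := by
  have h0 := H.pos n 0
  have h1 : ∑ x, p n x ^ s = (∑ x, (p n x / p n 0) ^ s) * p n 0 ^ s := by
    rw [Finset.sum_mul]
    refine Finset.sum_congr rfl fun x _ => ?_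
    rw [Real.div_rpow (H.pos n x).le h0.le, div_mul_cancel₀ _ (Real.rpow_pos_of_pos h0 s).ne']
  have h2 : 0 < ∑ x, (p n x / p n 0) ^ s :=
    IsOptimalGuessing.sum_rpow_pos (fun x => div_pos (H.pos n x) h0) s
  rw [h1, Real.log_mul h2.ne' (Real.rpow_pos_of_pos h0 s).ne', Real.log_rpow h0]

/-- At `s = 1` normalisation gives `∑ p x / p 0 = 1 / p 0`. -/
theorem tendsto_log_max (H : HasPowerSumRates p T C) :
    Tendsto (fun n : ℕ => (n : ℝ)⁻¹ * Real.log (p n 0)) atTop (𝓝 (-T 1)) := by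
  refine (H.tendsto 1 one_pos).neg.congr fun n => ?_
  have := H.log_sum_rpow n 1
  simp only [Real.rpow_one, H.sum_eq_one, Real.log_one, one_mul] at this ⊢
  have h2 : Real.log (p n 0) = -Real.log (∑ x, p n x / p n 0) := by linarith
  rw [h2]; ring

theorem tendsto_log_sum_rpow (H : HasPowerSumRates p T C) {s : ℝ} (hs : 0 < s) :
    Tendsto (fun n : ℕ => (n : ℝ)⁻¹ * Real.log (∑ x, p n x ^ s)) atTop (𝓝 (T s - s * T 1)) := by
  have := (H.tendsto s hs).add (H.tendsto_log_max.const_mul s)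
  have e : T s - s * T 1 = T s + s * -T 1 := by ring
  rw [e]
  refine this.congr fun n => ?_
  rw [H.log_sum_rpow]; ring

/-! #### Entropy rates -/

theorem hasRenyiRates (H : HasPowerSumRates p T C) :
    HasRenyiRates p fun s => 1 / (1 - s) * (T s - s * T 1) := by
  intro s hs _
  refine ((H.tendsto_log_sum_rpow hs).const_mul (1 / (1 - s))).congr fun n => ?_
  rw [renyiEntropy]; ring

theorem hasMinEntropyRate (H : HasPowerSumRates p T C) : HasMinEntropyRate p (T 1) := by
  refine ⟨_, H.hasRenyiRates, ?_⟩
  have h1 : Tendsto (fun s : ℝ => (1 - s)⁻¹) atTop (𝓝 0) := by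
    refine tendsto_inv_atBot_zero.comp ?_
    have := tendsto_atBot_add_const_left atTop (1 : ℝ) tendsto_neg_atTop_atBot
    exact this.congr fun s => (sub_eq_add_neg 1 s).symm
  -- The Rényi rate rewritten so that only `T 1` survives as `s → ∞`.
  have h2 : Tendsto (fun s : ℝ => (1 - s)⁻¹ * (T s - T 1) + T 1) atTop
      (𝓝 (0 * (0 - T 1) + T 1)) := (h1.mul (H.tendsto_zero.sub_const _)).add_const _
  rw [zero_mul, zero_add] at h2
  refine h2.congr' ?_
  filter_upwards [eventually_gt_atTop 1] with s hs
  have : 1 - s ≠ 0 := by linarith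
  field_simp
  ring

theorem hasShannonEntropyRate (H : HasPowerSumRates p T C) :
    HasShannonEntropyRate p (T 1 - deriv T 1) := by
  refine ⟨_, H.hasRenyiRates, ?_⟩
  have h1 := hasDerivAt_iff_tendsto_slope.1 (H.differentiableAt 1 one_pos).hasDerivAt
  -- The Rényi rate of order `s` equals `T 1` minus the slope of `T` between `1` and `s`.
  refine (h1.const_sub (T 1)).congr' ?_
  filter_upwards [self_mem_nhdsWithin] with s hs
  have h2 : 1 - s ≠ 0 := sub_ne_zero.2 (Ne.symm hs)
  have h3 : s - 1 ≠ 0 := sub_ne_zero.2 hs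
  rw [slope_def_field]
  field_simp
  ring

/-! #### The scaled cumulant generating function -/

theorem isProbabilityMeasure (H : HasPowerSumRates p T C) (G : ∀ n, BitString n → ℕ) (n : ℕ) :
    IsProbabilityMeasure (guessworkLaw (p n) (G n)) :=
  isProbabilityMeasure_guessworkLaw (fun x => (H.pos n x).le) (H.sum_eq_one n) _

theorem hasSCGF (H : HasPowerSumRates p T C) {G : ∀ n, BitString n → ℕ}
    (hG : ∀ n, IsOptimalGuessing (p n) (G n)) :
    HasSCGF (fun n => guessworkLaw (p n) (G n)) (guessworkSCGF T) := by
  intro α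
  have heq : (fun n : ℕ => (n : ℝ)⁻¹ * Real.log (∑ x, p n x * (G n x : ℝ) ^ α)) =ᶠ[atTop]
      fun n : ℕ => (n : ℝ)⁻¹ *
        Real.log (∫ a, Real.exp (α * n * a) ∂(guessworkLaw (p n) (G n))) := by
    filter_upwards [eventually_ne_atTop 0] with n hn
    rw [integral_exp_guessworkLaw (fun x => (H.pos n x).le) (hG n) hn]
  refine Tendsto.congr' heq ?_
  by_cases hα : α ≤ -1
  · rw [guessworkSCGF, if_pos hα]
    refine tendsto_inv_mul_of_abs_sub_le (c := 1) H.tendsto_log_max fun n => ?_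
    rw [one_mul]
    exact (hG n).abs_log_moment_sub_le_of_le_neg_one (H.pos n) (H.le_zero n) hα
  · rw [guessworkSCGF, if_neg hα]
    have hα' : -1 < α := not_le.1 hα
    have hα1 : 0 < 1 + α := by linarith
    refine tendsto_inv_mul_of_abs_sub_le
      (u := fun n => (1 + α) * Real.log (∑ x, p n x ^ (1 + α)⁻¹)) ?_
      fun n => (hG n).abs_log_moment_sub_le (H.pos n) hα'
    have := (H.tendsto_log_sum_rpow (inv_pos.2 hα1)).const_mul (1 + α)
    have e : (1 + α) * T (1 + α)⁻¹ - T 1 = (1 + α) * (T (1 + α)⁻¹ - (1 + α)⁻¹ * T 1) := by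
      field_simp
    rw [e]
    refine this.congr fun n => ?_
    ring

theorem hasDerivAt_guessworkSCGF (H : HasPowerSumRates p T C) {α : ℝ} (hα : -1 < α) :
    HasDerivAt (guessworkSCGF T) (T (1 + α)⁻¹ - (1 + α)⁻¹ * deriv T (1 + α)⁻¹) α := by
  have hα1 : 0 < 1 + α := by linarith
  have h1 : HasDerivAt (fun a : ℝ => 1 + a) 1 α := (hasDerivAt_id α).const_add 1
  have h2 := h1.inv hα1.ne'
  have h3 := (H.differentiableAt _ (inv_pos.2 hα1)).hasDerivAt.comp α h2
  have h4 := (h1.mul h3).sub_const (T 1)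
  have e : T (1 + α)⁻¹ - (1 + α)⁻¹ * deriv T (1 + α)⁻¹ =
      1 * T (1 + α)⁻¹ + (1 + α) * (deriv T (1 + α)⁻¹ * (-1 / (1 + α) ^ 2)) := by
    field_simp
    ring
  rw [e]
  refine h4.congr_of_eventuallyEq ?_
  filter_upwards [Ioi_mem_nhds hα] with a ha
  rw [guessworkSCGF, if_neg (not_le.2 ha)]
  rfl

/-- The delicate point is `-1`: the slope from the left is `0`, and from the right it is exactly `T
(1/(1+a))`, which tends to `0` because its argument tends to `∞`. -/
theorem differentiable_guessworkSCGF (H : HasPowerSumRates p T C) :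
    Differentiable ℝ (guessworkSCGF T) := by
  intro α
  rcases lt_trichotomy α (-1) with hα | rfl | hα
  · have : HasDerivAt (guessworkSCGF T) 0 α := by
      refine (hasDerivAt_const α (-T 1)).congr_of_eventuallyEq ?_
      filter_upwards [Iio_mem_nhds hα] with a ha
      rw [guessworkSCGF, if_pos (le_of_lt ha)]
    exact this.differentiableAt
  · have : HasDerivAt (guessworkSCGF T) 0 (-1) := by
      rw [hasDerivAt_iff_tendsto_slope, ← Set.Iio_union_Ioi, nhdsWithin_union]
      refine Tendsto.sup ?_ ?_
      · refine tendsto_const_nhds.congr' ?_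
        filter_upwards [self_mem_nhdsWithin] with a ha
        rw [slope_def_field, guessworkSCGF, guessworkSCGF, if_pos (le_of_lt ha), if_pos le_rfl]
        simp
      · have h1 : Tendsto (fun a : ℝ => (1 + a)⁻¹) (𝓝[>] (-1)) atTop := by
          refine tendsto_inv_nhdsGT_zero.comp ?_
          refine tendsto_nhdsWithin_iff.2 ⟨?_, ?_⟩
          · have hc : Continuous fun a : ℝ => 1 + a := by fun_prop
            simpa using (hc.tendsto (-1)).mono_left nhdsWithin_le_nhds
          · filter_upwards [self_mem_nhdsWithin] with a ha
            rw [Set.mem_Ioi] at ha ⊢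
            linarith
        refine (H.tendsto_zero.comp h1).congr' ?_
        filter_upwards [self_mem_nhdsWithin] with a ha
        have ha' : 0 < 1 + a := by rw [Set.mem_Ioi] at ha; linarith
        rw [slope_def_field, guessworkSCGF, guessworkSCGF, if_neg (not_le.2 ha), if_pos le_rfl,
          Function.comp_apply]
        have e : a - -1 = 1 + a := by ring
        rw [e]
        field_simp
        ring
    exact this.differentiableAt
  · exact (H.hasDerivAt_guessworkSCGF hα).differentiableAt

theorem isGuessworkSCGF (H : HasPowerSumRates p T C) :
    IsGuessworkSCGF (guessworkSCGF T) (T 1) C := by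
  choose G hG using fun n => exists_isOptimalGuessing (p n)
  have hΛ := H.hasSCGF hG
  have := H.isProbabilityMeasure G
  have hlog : ∀ n : ℕ, 0 < n → ∀ α : ℝ,
      Real.log (∫ a, Real.exp (α * n * a) ∂(guessworkLaw (p n) (G n))) =
        Real.log (∑ x, p n x * (G n x : ℝ) ^ α) := fun n hn α => by
    rw [integral_exp_guessworkLaw (fun x => (H.pos n x).le) (hG n) hn.ne']
  refine ⟨hΛ.convexOn fun n t => integrable_guessworkLaw _ _ _,
    H.differentiable_guessworkSCGF, hΛ.zero, fun α hα => if_pos hα, fun α hα => ?_, fun α => ?_⟩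
  · refine le_of_tendsto (hΛ α) ?_
    filter_upwards [eventually_gt_atTop 0] with n hn
    rw [hlog n hn, inv_mul_le_iff₀ (by exact_mod_cast hn)]
    exact (hG n).moment_le (H.pos n) (H.sum_eq_one n) hα
  · refine ge_of_tendsto (hΛ α) ?_
    filter_upwards [eventually_gt_atTop 0] with n hn
    rw [hlog n hn, le_inv_mul_iff₀ (by exact_mod_cast hn)]
    exact (hG n).le_moment (H.pos n) (H.exp_le n) α

theorem isGuessworkRateFunction (H : HasPowerSumRates p T C) :
    IsGuessworkRateFunction (legendreFenchel (guessworkSCGF T)) (T 1) (T 1 - deriv T 1) := by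
  refine H.isGuessworkSCGF.isGuessworkRateFunction ?_
  simpa using H.hasDerivAt_guessworkSCGF (show (-1 : ℝ) < 0 by norm_num)

theorem satisfiesLDP (H : HasPowerSumRates p T C) {G : ∀ n, BitString n → ℕ}
    (hG : ∀ n, IsOptimalGuessing (p n) (G n)) :
    SatisfiesLDP (fun n => guessworkLaw (p n) (G n)) (legendreFenchel (guessworkSCGF T)) :=
  have := H.isProbabilityMeasure G
  H.isGuessworkSCGF.satisfiesLDP (fun _ _ => integrable_guessworkLaw _ _ _) (H.hasSCGF hG)

end HasPowerSumRates

/-! ### Riemann sums of monotone functions -/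

/-- The left and right sums bracket the scaled integral, and their difference telescopes to `f (k/n)
- f 0`. The bound is uniform in `k`, as the hard-decision weights require. -/
theorem abs_riemannSum_sub_integral_le {f : ℝ → ℝ} (hf : MonotoneOn f (Set.Icc 0 1)) {n k : ℕ}
    (hn : 0 < n) (hk : k ≤ n) :
    |∑ j ∈ Finset.range k, f ((j : ℝ) / n) - n * ∫ u in (0 : ℝ)..(k / n : ℝ), f u| ≤ f 1 - f 0 ∧
    |∑ j ∈ Finset.range k, f (((j : ℝ) + 1) / n) - n * ∫ u in (0 : ℝ)..(k / n : ℝ), f u| ≤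
      f 1 - f 0 := by
  have hn' : (0 : ℝ) < n := by exact_mod_cast hn
  have hkn : (k : ℝ) / n ≤ 1 := (div_le_one hn').2 (by exact_mod_cast hk)
  have hg : MonotoneOn (fun t : ℝ => f (t / n)) (Set.Icc 0 (0 + k)) := by
    intro a ha b hb hab
    have hbn : b / n ≤ 1 := by
      refine le_trans ?_ hkn
      have := hb.2
      rw [zero_add] at this
      gcongr
    exact hf ⟨div_nonneg ha.1 hn'.le, (div_le_div_of_nonneg_right hab hn'.le).trans hbn⟩
      ⟨div_nonneg hb.1 hn'.le, hbn⟩ (div_le_div_of_nonneg_right hab hn'.le)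
  have h1 := hg.sum_le_integral
  have h2 := hg.integral_le_sum
  simp only [zero_add] at h1 h2
  rw [intervalIntegral.integral_comp_div _ hn'.ne', zero_div, smul_eq_mul] at h1 h2
  have h3 : ∑ j ∈ Finset.range k, f (((j + 1 : ℕ) : ℝ) / n) - ∑ j ∈ Finset.range k, f ((j : ℝ) / n) =
      f (k / n) - f 0 := by
    rw [← Finset.sum_sub_distrib, Finset.sum_range_sub (fun j : ℕ => f ((j : ℝ) / n))]
    simp
  have h4 : f (k / n) ≤ f 1 := hf ⟨by positivity, hkn⟩ ⟨zero_le_one, le_rfl⟩ hkn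
  simp only [Nat.cast_add, Nat.cast_one] at h2 h3
  constructor <;> rw [abs_le] <;> constructor <;> linarith

theorem tendsto_riemannSum {f : ℝ → ℝ} (hf : AntitoneOn f (Set.Icc 0 1)) :
    Tendsto (fun n : ℕ => (n : ℝ)⁻¹ * ∑ j : Fin n, f (((j : ℝ) + 1) / n)) atTop
      (𝓝 (∫ u in (0 : ℝ)..1, f u)) := by
  have h0 : Tendsto (fun n : ℕ => (n : ℝ)⁻¹ * (f 0 - f 1)) atTop (𝓝 0) := by
    simpa using tendsto_inv_atTop_nhds_zero_nat.mul_const (f 0 - f 1)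
  rw [tendsto_iff_norm_sub_tendsto_zero]
  refine squeeze_zero' (Eventually.of_forall fun n => norm_nonneg _) ?_ h0
  filter_upwards [eventually_gt_atTop 0] with n hn
  have hn' : (0 : ℝ) < n := by exact_mod_cast hn
  have := (abs_riemannSum_sub_integral_le hf.neg hn le_rfl).2
  simp only [Finset.sum_neg_distrib, intervalIntegral.integral_neg,
    div_self hn'.ne'] at this
  rw [Fin.sum_univ_eq_sum_range (fun j : ℕ => f (((j : ℝ) + 1) / n)) n, Real.norm_eq_abs]
  have e : (n : ℝ)⁻¹ * ∑ j ∈ Finset.range n, f (((j : ℝ) + 1) / n) - ∫ u in (0 : ℝ)..1, f u =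
      -((n : ℝ)⁻¹ * (-∑ j ∈ Finset.range n, f (((j : ℝ) + 1) / n) -
        n * -∫ u in (0 : ℝ)..1, f u)) := by
    field_simp
    ring
  rw [e, abs_neg, abs_mul, abs_of_pos (inv_pos.2 hn')]
  refine mul_le_mul_of_nonneg_left (this.trans_eq ?_) (inv_pos.2 hn').le
  ring

/-! ### Soft-decision noise -/

theorem sum_prod_ite {n : ℕ} (a b : Fin n → ℝ) :
    ∑ z : BitString n, ∏ i, (if z i = 0 then a i else b i) = ∏ i, (a i + b i) := by
  have h := Finset.prod_univ_sum (fun _ : Fin n => (Finset.univ : Finset (ZMod 2)))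
    (fun i c => if c = 0 then a i else b i)
  rw [Fintype.piFinset_univ] at h
  rw [← h]
  refine Finset.prod_congr rfl fun i _ => ?_
  -- `ZMod 2` is `Fin 2` by definition.
  exact (Fin.sum_univ_two (fun c : Fin 2 => if c = 0 then a i else b i)).trans (by simp)

/-- The odds `e^{-β i / n}` of a bit flip. -/
noncomputable def flipOdds (β : ℝ) (n : ℕ) (i : Fin n) : ℝ := Real.exp (-β * ((i : ℝ) + 1) / n)

section Soft

variable {β : ℝ} {n : ℕ}

theorem flipOdds_pos (β : ℝ) (i : Fin n) : 0 < flipOdds β n i := Real.exp_pos _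

theorem flipProb_pos (β : ℝ) (i : Fin n) : 0 < flipProb β n i := by
  unfold flipProb; positivity

theorem one_sub_flipProb (β : ℝ) (i : Fin n) : 1 - flipProb β n i = (1 + flipOdds β n i)⁻¹ := by
  have := flipOdds_pos β i
  unfold flipProb flipOdds at *
  field_simp
  ring

theorem flipProb_eq (β : ℝ) (i : Fin n) :
    flipProb β n i = flipOdds β n i * (1 - flipProb β n i) := by
  rw [one_sub_flipProb]; rfl

theorem one_sub_flipProb_pos (β : ℝ) (i : Fin n) : 0 < 1 - flipProb β n i := by
  have := flipOdds_pos β i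
  rw [one_sub_flipProb]; positivity

theorem flipOdds_le_one (hβ : 0 < β) (i : Fin n) : flipOdds β n i ≤ 1 := by
  refine Real.exp_le_one_iff.2 (div_nonpos_of_nonpos_of_nonneg ?_ (Nat.cast_nonneg n))
  have : (0 : ℝ) ≤ (i : ℝ) + 1 := by positivity
  nlinarith

theorem exp_neg_le_flipOdds (hβ : 0 < β) (i : Fin n) : Real.exp (-β) ≤ flipOdds β n i := by
  have hn : (0 : ℝ) < n := by exact_mod_cast (Nat.zero_le _).trans_lt i.2
  have hi : (i : ℝ) + 1 ≤ n := by exact_mod_cast i.2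
  refine Real.exp_le_exp.2 ?_
  rw [le_div_iff₀ hn]
  nlinarith

theorem flipProb_le (hβ : 0 < β) (i : Fin n) : flipProb β n i ≤ 1 - flipProb β n i := by
  exact (flipProb_eq β i).trans_le
    (mul_le_of_le_one_left (one_sub_flipProb_pos β i).le (flipOdds_le_one hβ i))

/-- The odds are at least `e^{-β}` and the no-flip probability at least `1/2`; this is where the
constant `β + ln 2` comes from. -/
theorem exp_neg_le_flipProb (hβ : 0 < β) (i : Fin n) :
    Real.exp (-(β + Real.log 2)) ≤ flipProb β n i := by
  rw [flipProb_eq, one_sub_flipProb, neg_add, Real.exp_add, Real.exp_neg (Real.log 2),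
    Real.exp_log two_pos]
  refine mul_le_mul (exp_neg_le_flipOdds hβ i) ?_ (by norm_num) (flipOdds_pos β i).le
  refine inv_anti₀ (by linarith [flipOdds_pos β i]) ?_
  linarith [flipOdds_le_one hβ i]

theorem softNoise_eq (τ : Equiv.Perm (Fin n)) (z : BitString n) :
    softNoise β τ z = ∏ i, if z i = 0 then 1 - flipProb β n (τ i) else flipProb β n (τ i) := rfl

theorem softNoise_pos (β : ℝ) (τ : Equiv.Perm (Fin n)) (z : BitString n) :
    0 < softNoise β τ z := by
  rw [softNoise_eq]
  refine Finset.prod_pos fun i _ => ?_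
  split_ifs
  exacts [one_sub_flipProb_pos β _, flipProb_pos β _]

theorem sum_softNoise (β : ℝ) (τ : Equiv.Perm (Fin n)) : ∑ z, softNoise β τ z = 1 := by
  simp_rw [softNoise_eq]
  rw [sum_prod_ite]
  simp

theorem softNoise_zero (β : ℝ) (τ : Equiv.Perm (Fin n)) :
    softNoise β τ 0 = ∏ i, (1 - flipProb β n i) := by
  rw [softNoise_eq]
  simpa using Equiv.prod_comp τ fun i => 1 - flipProb β n i

theorem softNoise_le_zero (hβ : 0 < β) (τ : Equiv.Perm (Fin n)) (z : BitString n) :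
    softNoise β τ z ≤ softNoise β τ 0 := by
  rw [softNoise_eq, softNoise_eq]
  refine Finset.prod_le_prod (fun i _ => ?_) fun i _ => ?_
  · split_ifs
    exacts [(one_sub_flipProb_pos β _).le, (flipProb_pos β _).le]
  · rw [if_pos (Pi.zero_apply i)]
    split_ifs
    exacts [le_rfl, flipProb_le hβ _]

theorem exp_le_softNoise (hβ : 0 < β) (τ : Equiv.Perm (Fin n)) (z : BitString n) :
    Real.exp (-((β + Real.log 2) * n)) ≤ softNoise β τ z := by
  have : Real.exp (-((β + Real.log 2) * n)) = ∏ _i : Fin n, Real.exp (-(β + Real.log 2)) := by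
    rw [Finset.prod_const, Finset.card_univ, Fintype.card_fin, ← Real.exp_nat_mul]
    congr 1; ring
  rw [this, softNoise_eq]
  refine Finset.prod_le_prod (fun i _ => (Real.exp_pos _).le) fun i _ => ?_
  split_ifs
  exacts [(exp_neg_le_flipProb hβ _).trans (flipProb_le hβ _), exp_neg_le_flipProb hβ _]

theorem softNoise_div_zero (β : ℝ) (τ : Equiv.Perm (Fin n)) (z : BitString n) :
    softNoise β τ z / softNoise β τ 0 = ∏ i, if z i = 0 then 1 else flipOdds β n (τ i) := by
  rw [softNoise_eq, softNoise_eq, ← Finset.prod_div_distrib]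
  refine Finset.prod_congr rfl fun i _ => ?_
  have := (one_sub_flipProb_pos β (τ i)).ne'
  rw [if_pos (Pi.zero_apply i)]
  split_ifs
  · exact div_self this
  · exact (div_eq_iff this).2 (flipProb_eq β _)

theorem sum_softNoise_div_rpow (β : ℝ) (τ : Equiv.Perm (Fin n)) (s : ℝ) :
    ∑ z, (softNoise β τ z / softNoise β τ 0) ^ s =
      ∏ i : Fin n, (1 + Real.exp (-(s * β) * (((i : ℝ) + 1) / n))) := by
  have h1 : ∀ z : BitString n, (softNoise β τ z / softNoise β τ 0) ^ s =
      ∏ i, if z i = 0 then 1 else flipOdds β n (τ i) ^ s := by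
    intro z
    rw [softNoise_div_zero, ← Real.finsetProd_rpow]
    · refine Finset.prod_congr rfl fun i _ => ?_
      split_ifs
      exacts [Real.one_rpow s, rfl]
    · intro i _
      split_ifs
      exacts [zero_le_one, (flipOdds_pos β _).le]
  simp_rw [h1]
  rw [sum_prod_ite, Equiv.prod_comp τ fun i => 1 + flipOdds β n i ^ s]
  refine Finset.prod_congr rfl fun i _ => ?_
  rw [flipOdds, ← Real.exp_mul]
  congr 2
  ring

/-- The power-sum rates of the soft-decision noise effect,
`T s = ∫₀¹ ln (1 + e^{-sβu}) du`. -/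
noncomputable def softRate (β s : ℝ) : ℝ :=
  s⁻¹ * ∫ v in (0 : ℝ)..s, Real.log (1 + Real.exp (-β * v))

theorem continuous_log_one_add_exp (c : ℝ) :
    Continuous fun v : ℝ => Real.log (1 + Real.exp (c * v)) :=
  Continuous.log (by fun_prop) fun v => by positivity

theorem softRate_eq {s : ℝ} (hs : 0 < s) :
    softRate β s = ∫ u in (0 : ℝ)..1, Real.log (1 + Real.exp (-(s * β) * u)) := by
  have := intervalIntegral.integral_comp_mul_left (a := 0) (b := 1)
    (fun v => Real.log (1 + Real.exp (-β * v))) hs.ne'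
  simp only [mul_zero, mul_one, smul_eq_mul] at this
  rw [softRate, ← this]
  refine intervalIntegral.integral_congr fun u _ => ?_
  congr 3
  ring

/-- With `s` moved to the upper limit of integration, the fundamental theorem of calculus replaces
differentiation under the integral. -/
theorem differentiableAt_softRate (β : ℝ) {s : ℝ} (hs : 0 < s) :
    DifferentiableAt ℝ (softRate β) s :=
  (differentiableAt_inv hs.ne').mul
    ((continuous_log_one_add_exp (-β)).integral_hasStrictDerivAt 0 s).hasDerivAt.differentiableAt

theorem tendsto_softRate (hβ : 0 < β) : Tendsto (softRate β) atTop (𝓝 0) := by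
  have h0 : Tendsto (fun s : ℝ => s⁻¹ * β⁻¹) atTop (𝓝 0) := by
    simpa using tendsto_inv_atTop_zero.mul_const β⁻¹
  refine squeeze_zero' ?_ ?_ h0
  · filter_upwards [eventually_gt_atTop 0] with s hs
    refine mul_nonneg (inv_nonneg.2 hs.le) (intervalIntegral.integral_nonneg hs.le fun v _ => ?_)
    exact Real.log_nonneg (by linarith [Real.exp_pos (-β * v)])
  · filter_upwards [eventually_gt_atTop 0] with s hs
    refine mul_le_mul_of_nonneg_left ?_ (inv_nonneg.2 hs.le)
    calc ∫ v in (0 : ℝ)..s, Real.log (1 + Real.exp (-β * v))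
        ≤ ∫ v in (0 : ℝ)..s, Real.exp (-β * v) := by
          refine intervalIntegral.integral_mono_on hs.le
            ((continuous_log_one_add_exp (-β)).intervalIntegrable _ _)
            ((by fun_prop : Continuous fun v : ℝ => Real.exp (-β * v)).intervalIntegrable _ _)
            fun v _ => ?_
          have := Real.log_le_sub_one_of_pos (show 0 < 1 + Real.exp (-β * v) by positivity)
          linarith
      _ = β⁻¹ * (1 - Real.exp (-β * s)) := by
          rw [intervalIntegral.integral_comp_mul_left (fun v => Real.exp v) (neg_ne_zero.2 hβ.ne'),
            integral_exp, smul_eq_mul, mul_zero, Real.exp_zero, inv_neg]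
          ring
      _ ≤ β⁻¹ := mul_le_of_le_one_right (inv_nonneg.2 hβ.le)
          (by linarith [Real.exp_pos (-β * s)])

theorem hasPowerSumRates_softNoise (hβ : 0 < β) (τ : ∀ n, Equiv.Perm (Fin n)) :
    HasPowerSumRates (fun n => softNoise β (τ n)) (softRate β) (β + Real.log 2) where
  pos n := softNoise_pos β (τ n)
  sum_eq_one n := sum_softNoise β (τ n)
  le_zero n := softNoise_le_zero hβ (τ n)
  exp_le n := exp_le_softNoise hβ (τ n)
  tendsto s hs := by
    rw [softRate_eq hs]
    have hanti : AntitoneOn (fun u : ℝ => Real.log (1 + Real.exp (-(s * β) * u)))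
        (Set.Icc 0 1) := by
      intro a _ b _ hab
      refine Real.log_le_log (by positivity) (add_le_add_right (Real.exp_le_exp.2 ?_) 1)
      exact mul_le_mul_of_nonpos_left hab (by nlinarith)
    refine (tendsto_riemannSum hanti).congr fun n => ?_
    rw [sum_softNoise_div_rpow, Real.log_prod fun i _ => by positivity]
  differentiableAt s hs := differentiableAt_softRate β hs
  tendsto_zero := tendsto_softRate hβ

end Soft

/-! ### Binomial coefficients and binary entropy -/

/-- The ratio of consecutive terms, `(n - j) x / ((j + 1) (1 - x))` with `x = k/n`, is at least `1`
for `j < k` and at most `1` for `j ≥ k`. -/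
theorem binomial_term_le_mode {n k : ℕ} (hk : 0 < k) (hkn : k < n) (j : ℕ) (hj : j ≤ n) :
    (n.choose j : ℝ) * ((k / n : ℝ) ^ j * (1 - k / n : ℝ) ^ (n - j)) ≤
      n.choose k * ((k / n : ℝ) ^ k * (1 - k / n : ℝ) ^ (n - k)) := by
  have hn : (0 : ℝ) < n := by exact_mod_cast hk.trans hkn
  have hk' : (0 : ℝ) < k := by exact_mod_cast hk
  have hkn' : (k : ℝ) < n := by exact_mod_cast hkn
  set x : ℝ := k / n with hx
  have hxn : x * n = k := by rw [hx]; field_simp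
  have hx0 : 0 < x := div_pos hk' hn
  have hx1 : 0 < 1 - x := by
    rw [sub_pos, hx, div_lt_one hn]; exact hkn'
  set t : ℕ → ℝ := fun j => (n.choose j : ℝ) * (x ^ j * (1 - x) ^ (n - j)) with ht
  have ht0 : ∀ j, 0 ≤ t j := fun j => by positivity
  have hrec : ∀ j, j < n → t (j + 1) * ((j + 1) * (1 - x)) = t j * ((n - j) * x) := by
    intro j hjn
    have h1 : (n.choose (j + 1) : ℝ) * (j + 1) = n.choose j * (n - j) := by
      have := Nat.choose_succ_right_eq n j
      rw [← Nat.cast_sub hjn.le]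
      exact_mod_cast this
    have h2 : n - j = n - (j + 1) + 1 := by omega
    simp only [ht]
    rw [h2, pow_succ, pow_succ]
    linear_combination (x ^ j * x * (1 - x) ^ (n - (j + 1)) * (1 - x)) * h1
  have hup : ∀ j, j < k → t j ≤ t (j + 1) := by
    intro j hjk
    have hjk' : (j : ℝ) + 1 ≤ k := by exact_mod_cast hjk
    have h1 : ((j : ℝ) + 1) * (1 - x) ≤ (n - j) * x := by
      have : ((j : ℝ) + 1) * (1 - x) ≤ k * (1 - x) := mul_le_mul_of_nonneg_right hjk' hx1.le
      have : ((n : ℝ) - k) * x ≤ (n - j) * x := mul_le_mul_of_nonneg_right (by linarith) hx0.le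
      nlinarith
    have h2 := hrec j (hjk.trans hkn)
    have h3 : 0 < ((j : ℝ) + 1) * (1 - x) := by positivity
    refine le_of_mul_le_mul_right ?_ h3
    rw [h2]
    exact mul_le_mul_of_nonneg_left h1 (ht0 j)
  have hdown : ∀ j, k ≤ j → j < n → t (j + 1) ≤ t j := by
    intro j hkj hjn
    have hkj' : (k : ℝ) ≤ j := by exact_mod_cast hkj
    have h1 : ((n : ℝ) - j) * x ≤ (j + 1) * (1 - x) := by
      have : (k : ℝ) * (1 - x) ≤ (j + 1) * (1 - x) :=
        mul_le_mul_of_nonneg_right (by linarith) hx1.le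
      have : ((n : ℝ) - j) * x ≤ (n - k) * x := mul_le_mul_of_nonneg_right (by linarith) hx0.le
      nlinarith
    have h2 := hrec j hjn
    have h3 : 0 < ((j : ℝ) + 1) * (1 - x) := by positivity
    refine le_of_mul_le_mul_right ?_ h3
    rw [h2]
    exact mul_le_mul_of_nonneg_left h1 (ht0 j)
  change t j ≤ t k
  rcases le_total j k with h | h
  · refine Nat.decreasingInduction' (P := fun j => t j ≤ t k)
      (fun i hi _ ih => (hup i hi).trans ih) h le_rfl
  · induction j, h using Nat.le_induction with
    | base => exact le_rfl
    | succ j hkj ih => exact (hdown j hkj hj).trans (ih (by omega))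

/-- Under the binomial law with parameter `k/n`, the term at `k` is `C(n,k) e^{-n h(k/n)}`. It is at
most the total mass `1`, and as the largest of `n + 1` terms at least `1/(n+1)`. -/
theorem choose_bounds_exp_binEntropy {n k : ℕ} (hn : 0 < n) (hk : k ≤ n) :
    (n.choose k : ℝ) ≤ Real.exp (n * Real.binEntropy (k / n)) ∧
      Real.exp (n * Real.binEntropy (k / n)) ≤ (n + 1) * n.choose k := by
  have hn' : (0 : ℝ) < n := by exact_mod_cast hn
  rcases Nat.eq_zero_or_pos k with rfl | hk0
  · simp
  rcases hk.eq_or_lt with rfl | hkn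
  · simp [hn'.ne']
  have hk' : (0 : ℝ) < k := by exact_mod_cast hk0
  have hkn' : (k : ℝ) < n := by exact_mod_cast hkn
  have hx0 : (0 : ℝ) < k / n := div_pos hk' hn'
  have hx1 : (0 : ℝ) < 1 - k / n := by rw [sub_pos, div_lt_one hn']; exact hkn'
  set M : ℝ := (k / n : ℝ) ^ k * (1 - k / n : ℝ) ^ (n - k) with hM
  have hM0 : 0 < M := by positivity
  have hexp : Real.exp (n * Real.binEntropy (k / n)) * M = 1 := by
    have h1 : M = Real.exp (k * Real.log (k / n) + (n - k) * Real.log (1 - k / n)) := by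
      rw [Real.exp_add, ← Nat.cast_sub hk, Real.exp_nat_mul, Real.exp_nat_mul, Real.exp_log hx0,
        Real.exp_log hx1]
    rw [h1, ← Real.exp_add, Real.exp_eq_one_iff, Real.binEntropy, Real.log_inv, Real.log_inv]
    field_simp
    ring
  have hsum : ∑ j ∈ Finset.range (n + 1),
      (n.choose j : ℝ) * ((k / n : ℝ) ^ j * (1 - k / n : ℝ) ^ (n - j)) = 1 := by
    have := add_pow (k / n : ℝ) (1 - k / n) n
    rw [add_sub_cancel, one_pow] at this
    exact Eq.trans (Finset.sum_congr rfl fun j _ => mul_comm _ _) this.symm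
  constructor
  · refine le_of_mul_le_mul_right ?_ hM0
    rw [hexp, ← hsum]
    exact Finset.single_le_sum
      (f := fun j => (n.choose j : ℝ) * ((k / n : ℝ) ^ j * (1 - k / n : ℝ) ^ (n - j)))
      (fun j _ => by positivity) (Finset.mem_range.2 (by omega))
  · refine le_of_mul_le_mul_right ?_ hM0
    rw [hexp]
    refine hsum.symm.le.trans ((Finset.sum_le_card_nsmul _ _ _ fun j hj =>
      binomial_term_le_mode hk0 hkn j (Nat.lt_succ_iff.1 (Finset.mem_range.1 hj))).trans_eq ?_)
    rw [Finset.card_range, nsmul_eq_mul]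
    push_cast
    ring

/-! ### Differentiability of parametric maxima -/

/-- Danskin's theorem for families of functions affine in the parameter. -/
theorem hasDerivAt_of_unique_isMaxOn {K : Set ℝ} (hK : IsCompact K) {h c : ℝ → ℝ}
    (hh : ContinuousOn h K) (hc : ContinuousOn c K) {T : ℝ → ℝ}
    (hT : ∀ s, ∃ x ∈ K, T s = h x - s * c x) (hle : ∀ s, ∀ x ∈ K, h x - s * c x ≤ T s)
    {s₀ x₀ : ℝ} (hx₀ : x₀ ∈ K)
    (huniq : ∀ x ∈ K, x ≠ x₀ → h x - s₀ * c x < T s₀) : HasDerivAt T (-c x₀) s₀ := by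
  have hT₀ : T s₀ = h x₀ - s₀ * c x₀ := by
    obtain ⟨x, hx, hxT⟩ := hT s₀
    by_cases hxx : x = x₀
    · rw [hxT, hxx]
    · exact absurd hxT (huniq x hx hxx).ne'
  obtain ⟨B, hB⟩ := hK.exists_bound_of_continuousOn hc
  have hB0 : 0 ≤ B := (norm_nonneg _).trans (hB x₀ hx₀)
  rw [hasDerivAt_iff_isLittleO, Asymptotics.isLittleO_iff]
  intro ε hε
  -- Maximisers at `s` near `s₀` need not be shown to approach `x₀`; it suffices that their values
  -- of `c` approach `c x₀`. Compactness gives a uniform gap `η` where `c` is far from `c x₀`, and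
  -- moving `s` by less than `η / (2B + 1)` cannot close it.
  obtain ⟨η, hη, hgap⟩ : ∃ η > 0, ∀ x ∈ K, ε ≤ |c x - c x₀| → h x - s₀ * c x + η ≤ T s₀ := by
    have hK' : IsCompact (K ∩ {x | ε ≤ |c x - c x₀|}) := by
      have hcont : ContinuousOn (fun x => |c x - c x₀|) K := (hc.sub continuousOn_const).abs
      refine hK.of_isClosed_subset ?_ Set.inter_subset_left
      exact hcont.preimage_isClosed_of_isClosed hK.isClosed isClosed_Ici
    rcases (K ∩ {x | ε ≤ |c x - c x₀|}).eq_empty_or_nonempty with he | hne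
    · refine ⟨1, one_pos, fun x hx hxε => ?_⟩
      have : x ∈ K ∩ {x | ε ≤ |c x - c x₀|} := ⟨hx, hxε⟩
      rw [he] at this
      exact this.elim
    · have hφ : ContinuousOn (fun x => h x - s₀ * c x) (K ∩ {x | ε ≤ |c x - c x₀|}) :=
        (hh.sub (continuousOn_const.mul hc)).mono Set.inter_subset_left
      obtain ⟨y, hy, hmax⟩ := hK'.exists_isMaxOn hne hφ
      have hyx : y ≠ x₀ := by
        rintro rfl
        have : ε ≤ |c y - c y| := hy.2
        rw [sub_self, abs_zero] at this
        linarith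
      refine ⟨T s₀ - (h y - s₀ * c y), sub_pos.2 (huniq y hy.1 hyx), fun x hx hxε => ?_⟩
      have h1 : h x - s₀ * c x ≤ h y - s₀ * c y := hmax ⟨hx, hxε⟩
      linarith
  filter_upwards [Metric.ball_mem_nhds s₀ (show 0 < η / (2 * B + 1) by positivity)] with s hs
  rw [Metric.mem_ball, Real.dist_eq, lt_div_iff₀ (by positivity)] at hs
  obtain ⟨x, hx, hxT⟩ := hT s
  have h1 := hle s x₀ hx₀
  have h2 := hle s₀ x hx
  have hcx : |c x - c x₀| < ε := by
    by_contra hcon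
    have h3 := hgap x hx (not_lt.1 hcon)
    have h4 := abs_le.1 (hB x hx)
    have h5 := abs_le.1 (hB x₀ hx₀)
    have h6 : |(s - s₀) * (c x - c x₀)| ≤ |s - s₀| * (2 * B) := by
      rw [abs_mul]
      exact mul_le_mul_of_nonneg_left (abs_le.2 ⟨by linarith, by linarith⟩) (abs_nonneg _)
    have h7 := abs_le.1 h6
    have h8 := abs_nonneg (s - s₀)
    nlinarith
  rw [smul_eq_mul, Real.norm_eq_abs, Real.norm_eq_abs]
  have h9 : |(s - s₀) * (c x - c x₀)| ≤ |s - s₀| * ε := by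
    rw [abs_mul]
    exact mul_le_mul_of_nonneg_left hcx.le (abs_nonneg _)
  have h10 := abs_le.1 h9
  rw [abs_le]
  constructor <;> nlinarith

/-! ### Elementary symmetric sums of geometric progressions -/

/-- The elementary symmetric polynomial of degree `k` in `q, q², …, qⁿ`. -/
noncomputable def geomEsymm (q : ℝ) (n k : ℕ) : ℝ :=
  ∑ t ∈ (Finset.range n).powersetCard k, ∏ i ∈ t, q ^ (i + 1)

theorem geomEsymm_zero (q : ℝ) (n : ℕ) : geomEsymm q n 0 = 1 := by
  simp [geomEsymm]

theorem geomEsymm_succ_succ (q : ℝ) (n k : ℕ) :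
    geomEsymm q (n + 1) (k + 1) = geomEsymm q n (k + 1) + q ^ (n + 1) * geomEsymm q n k := by
  have hmem : ∀ t ∈ (Finset.range n).powersetCard k, n ∉ t := fun t ht hn =>
    Finset.notMem_range_self ((Finset.mem_powersetCard.1 ht).1 hn)
  simp only [geomEsymm]
  rw [Finset.range_add_one, Finset.powersetCard_succ_insert Finset.notMem_range_self,
    Finset.sum_union, Finset.sum_image, Finset.mul_sum]
  · congr 1
    exact Finset.sum_congr rfl fun t ht => Finset.prod_insert (hmem t ht)
  · intro t ht u hu htu
    rw [← Finset.erase_insert (hmem t ht), ← Finset.erase_insert (hmem u hu)]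
    exact congrArg (fun v : Finset ℕ => v.erase n) htu
  · rw [Finset.disjoint_right]
    intro t ht ht'
    obtain ⟨u, -, rfl⟩ := Finset.mem_image.1 ht
    exact Finset.notMem_range_self
      ((Finset.mem_powersetCard.1 ht').1 (Finset.mem_insert_self n u))

/-- The ratio of consecutive `q`-binomial coefficients, kept free of division so that induction on
`n` is a linear combination of two instances. -/
theorem geomEsymm_succ_mul (q : ℝ) (n k : ℕ) :
    geomEsymm q n (k + 1) * (1 - q ^ (k + 1)) =
      geomEsymm q n k * (q ^ (k + 1) - q ^ (n + 1)) := by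
  induction n generalizing k with
  | zero =>
    have h0 : ∀ k, geomEsymm q 0 (k + 1) = 0 := fun k => by
      rw [geomEsymm, Finset.powersetCard_eq_empty.2 (by simp), Finset.sum_empty]
    cases k with
    | zero => simp [h0]
    | succ k => simp [h0]
  | succ n ih =>
    rw [geomEsymm_succ_succ]
    cases k with
    | zero =>
      have h1 := ih 0
      simp only [geomEsymm_zero] at h1 ⊢
      linear_combination h1
    | succ k =>
      rw [geomEsymm_succ_succ]
      linear_combination ih (k + 1) + q ^ (n + 1) * q * ih k

/-! ### Hard-decision noise -/

section Hard

variable {β : ℝ} {n : ℕ}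

/-- The average of `∏ i ∈ S, w (τ i)` over all permutations `τ`. -/
noncomputable def permAverage (w : Fin n → ℝ) (S : Finset (Fin n)) : ℝ :=
  (n.factorial : ℝ)⁻¹ * ∑ τ : Equiv.Perm (Fin n), ∏ i ∈ S, w (τ i)

/-- A bijection `S ≃ S'` extends to a permutation `σ`, and `τ ↦ τ * σ` only reorders the average. -/
theorem permAverage_eq_of_card_eq (w : Fin n → ℝ) {S S' : Finset (Fin n)} (h : S.card = S'.card) :
    permAverage w S = permAverage w S' := by
  let e : {x // x ∈ S} ≃ {x // x ∈ S'} := Finset.equivOfCardEq h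
  let σ : Equiv.Perm (Fin n) := e.extendSubtype
  rw [permAverage, permAverage]
  congr 1
  rw [← Equiv.sum_comp (Equiv.mulRight σ) fun τ : Equiv.Perm (Fin n) => ∏ i ∈ S, w (τ i)]
  refine Finset.sum_congr rfl fun τ _ => ?_
  rw [← Finset.prod_coe_sort S, ← Finset.prod_coe_sort S', ← e.prod_comp]
  refine Finset.prod_congr rfl fun i _ => ?_
  simp only [Equiv.coe_mulRight, Equiv.Perm.coe_mul, Function.comp_apply]
  rw [show σ i = e i from Equiv.extendSubtype_apply_of_mem e i i.2]

theorem sum_powersetCard_permAverage (w : Fin n → ℝ) (k : ℕ) :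
    ∑ S ∈ Finset.univ.powersetCard k, permAverage w S =
      ∑ S ∈ (Finset.univ : Finset (Fin n)).powersetCard k, ∏ i ∈ S, w i := by
  have h : ∀ τ : Equiv.Perm (Fin n),
      ∑ S ∈ (Finset.univ : Finset (Fin n)).powersetCard k, ∏ i ∈ S, w (τ i) =
        ∑ S ∈ (Finset.univ : Finset (Fin n)).powersetCard k, ∏ i ∈ S, w i := by
    intro τ
    have := Finset.powersetCard_map τ.toEmbedding k (Finset.univ : Finset (Fin n))
    rw [Finset.map_univ_equiv] at this
    conv_rhs => rw [this, Finset.sum_map]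
    refine Finset.sum_congr rfl fun S _ => ?_
    simp [Finset.prod_map]
  simp only [permAverage]
  rw [← Finset.mul_sum, Finset.sum_comm, Finset.sum_congr rfl fun τ _ => h τ, Finset.sum_const,
    Finset.card_univ, Fintype.card_perm, Fintype.card_fin, nsmul_eq_mul, ← mul_assoc,
    inv_mul_cancel₀ (by positivity), one_mul]

theorem permAverage_mul_choose (w : Fin n → ℝ) (S : Finset (Fin n)) :
    permAverage w S * n.choose S.card =
      ∑ S' ∈ (Finset.univ : Finset (Fin n)).powersetCard S.card, ∏ i ∈ S', w i := by
  rw [← sum_powersetCard_permAverage, Finset.sum_congr rfl fun S' hS' =>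
    permAverage_eq_of_card_eq w (Finset.mem_powersetCard.1 hS').2, Finset.sum_const,
    Finset.card_powersetCard, Finset.card_univ, Fintype.card_fin, nsmul_eq_mul, mul_comm]

theorem sum_powersetCard_flipOdds (β : ℝ) (n k : ℕ) :
    ∑ S ∈ (Finset.univ : Finset (Fin n)).powersetCard k, ∏ i ∈ S, flipOdds β n i =
      geomEsymm (Real.exp (-β / n)) n k := by
  have h1 : (Finset.range n).powersetCard k =
      ((Finset.univ : Finset (Fin n)).map Fin.valEmbedding).powersetCard k := by
    congr 1
    ext i
    simp
  rw [geomEsymm, h1, Finset.powersetCard_map, Finset.sum_map]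
  refine Finset.sum_congr rfl fun S _ => ?_
  simp only [Finset.mapEmbedding_apply, RelEmbedding.coe_toEmbedding, Finset.prod_map,
    Fin.valEmbedding_apply]
  refine Finset.prod_congr rfl fun i _ => ?_
  rw [flipOdds, ← Real.exp_nat_mul]
  congr 1
  push_cast
  ring

/-- The probability of a noise sequence of Hamming weight `k` under hard decision, relative to
that of the zero sequence. -/
noncomputable def hardRatio (β : ℝ) (n k : ℕ) : ℝ :=
  geomEsymm (Real.exp (-β / n)) n k / n.choose k

theorem permAverage_flipOdds (S : Finset (Fin n)) :
    permAverage (flipOdds β n) S = hardRatio β n S.card := by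
  have hc : 0 < n.choose S.card := Nat.choose_pos (by simpa using S.card_le_univ)
  rw [hardRatio, ← sum_powersetCard_flipOdds, ← permAverage_mul_choose,
    mul_div_cancel_right₀ _ (by exact_mod_cast hc.ne')]

theorem hardNoise_zero (β : ℝ) (n : ℕ) : hardNoise β n 0 = ∏ i, (1 - flipProb β n i) := by
  simp only [hardNoise, softNoise_zero]
  rw [Finset.sum_const, Finset.card_univ, Fintype.card_perm, Fintype.card_fin, nsmul_eq_mul,
    ← mul_assoc, inv_mul_cancel₀ (by positivity), one_mul]

theorem hardNoise_div_zero (β : ℝ) (n : ℕ) (z : BitString n) :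
    hardNoise β n z / hardNoise β n 0 =
      hardRatio β n (Finset.univ.filter fun i => ¬z i = 0).card := by
  rw [← permAverage_flipOdds, hardNoise_zero, hardNoise, permAverage, mul_div_assoc,
    Finset.sum_div]
  congr 1
  refine Finset.sum_congr rfl fun τ _ => ?_
  rw [← softNoise_zero β τ, softNoise_div_zero, Finset.prod_filter]
  refine Finset.prod_congr rfl fun i _ => ?_
  by_cases h : z i = 0 <;> simp [h]

theorem sum_comp_support (f : Finset (Fin n) → ℝ) :
    ∑ z : BitString n, f (Finset.univ.filter fun i => ¬z i = 0) = ∑ S, f S := by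
  refine Fintype.sum_bijective (fun z : BitString n => Finset.univ.filter fun i => ¬z i = 0)
    ⟨fun z z' h => ?_, fun S => ⟨fun i => if i ∈ S then 1 else 0, ?_⟩⟩ _ _ fun z => rfl
  · funext i
    have h1 : (¬z i = 0) ↔ ¬z' i = 0 := by
      have := Finset.ext_iff.1 h i
      simpa using this
    generalize z i = a at *
    generalize z' i = b at *
    revert a b
    decide
  · ext i
    simp

theorem sum_hardNoise_div_rpow (β : ℝ) (n : ℕ) (s : ℝ) :
    ∑ z, (hardNoise β n z / hardNoise β n 0) ^ s =
      ∑ k ∈ Finset.range (n + 1), n.choose k * hardRatio β n k ^ s := by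
  simp_rw [hardNoise_div_zero]
  rw [sum_comp_support fun S => hardRatio β n S.card ^ s, ← Finset.powerset_univ,
    Finset.sum_powerset_apply_card fun k => hardRatio β n k ^ s]
  simp

theorem hardRatio_zero (β : ℝ) (n : ℕ) : hardRatio β n 0 = 1 := by
  simp [hardRatio, geomEsymm_zero]

/-- The factor `(n - k)/(k + 1)` from the binomial coefficients is distributed so that both
quotients become moment generating functions of the uniform law on `[0, 1]`, at `-β(n-k)/n` and
`β(k+1)/n`. -/
theorem hardRatio_succ (hβ : 0 < β) {k : ℕ} (hk : k < n) :
    hardRatio β n (k + 1) = hardRatio β n k *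
      (((1 - Real.exp (-(β * (n - k) / n))) / (β * (n - k) / n)) /
        ((Real.exp (β * (k + 1) / n) - 1) / (β * (k + 1) / n))) := by
  have hn : (0 : ℝ) < n := by exact_mod_cast (Nat.zero_le k).trans_lt hk
  have hnk : (0 : ℝ) < n - k := sub_pos.2 (by exact_mod_cast hk)
  have hk1 : (0 : ℝ) < k + 1 := by positivity
  have hc0 : (0 : ℝ) < n.choose k := by exact_mod_cast Nat.choose_pos hk.le
  have hc1 : (0 : ℝ) < n.choose (k + 1) := by exact_mod_cast Nat.choose_pos hk
  have hc : (n.choose (k + 1) : ℝ) * (k + 1) = n.choose k * (n - k) := by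
    rw [← Nat.cast_sub hk.le]
    exact_mod_cast Nat.choose_succ_right_eq n k
  have hE := geomEsymm_succ_mul (Real.exp (-β / n)) n k
  have hq1 : Real.exp (-β / n) ^ (k + 1) = (Real.exp (β * (k + 1) / n))⁻¹ := by
    rw [← Real.exp_nat_mul, ← Real.exp_neg]
    congr 1
    push_cast
    ring
  have hq2 : Real.exp (-β / n) ^ (n + 1) =
      Real.exp (-(β * (n - k) / n)) * (Real.exp (β * (k + 1) / n))⁻¹ := by
    rw [← Real.exp_nat_mul, ← Real.exp_neg, ← Real.exp_add]
    congr 1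
    push_cast
    field_simp
    ring
  have hb : 1 < Real.exp (β * (k + 1) / n) := Real.one_lt_exp_iff.2 (by positivity)
  rw [hq1, hq2] at hE
  set b := Real.exp (β * (k + 1) / n)
  set a := Real.exp (-(β * (n - k) / n))
  have hb0 : 0 < b := by linarith
  have hb1 : 0 < b - 1 := by linarith
  have hE' : geomEsymm (Real.exp (-β / n)) n (k + 1) * (b - 1) =
      geomEsymm (Real.exp (-β / n)) n k * (1 - a) := by
    have h1 : b * b⁻¹ = 1 := mul_inv_cancel₀ hb0.ne'
    linear_combination b * hE +
      (geomEsymm (Real.exp (-β / n)) n (k + 1) + geomEsymm (Real.exp (-β / n)) n k * (1 - a)) * h1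
  have h2 : geomEsymm (Real.exp (-β / n)) n (k + 1) =
      geomEsymm (Real.exp (-β / n)) n k * (1 - a) / (b - 1) := by
    rw [eq_div_iff hb1.ne', hE']
  have h3 : (n.choose (k + 1) : ℝ) = n.choose k * (n - k) / (k + 1) := by
    rw [eq_div_iff hk1.ne', hc]
  rw [hardRatio, hardRatio, h2, h3]
  field_simp

end Hard

/-! ### The cumulant generating function of the uniform distribution on `[0, 1]` -/

/-- The cumulant generating function of the uniform distribution on `[0, 1]`. -/
noncomputable def unifCgf (t : ℝ) : ℝ := cgf id (volume.restrict (Set.Icc (0 : ℝ) 1)) t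

theorem integrable_exp_mul_unif (t : ℝ) :
    Integrable (fun u => Real.exp (t * u)) (volume.restrict (Set.Icc (0 : ℝ) 1)) :=
  (by fun_prop : Continuous fun u : ℝ => Real.exp (t * u)).integrableOn_Icc

theorem convexOn_unifCgf : ConvexOn ℝ Set.univ unifCgf :=
  convexOn_cgf (X := id) integrable_exp_mul_unif

theorem differentiable_unifCgf : Differentiable ℝ unifCgf := by
  intro t
  refine (analyticAt_cgf (X := id) (μ := volume.restrict (Set.Icc (0 : ℝ) 1)) ?_).differentiableAt
  have : integrableExpSet id (volume.restrict (Set.Icc (0 : ℝ) 1)) = Set.univ :=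
    Set.eq_univ_of_forall integrable_exp_mul_unif
  simp [this]

theorem unifCgf_zero : unifCgf 0 = 0 := by
  simp [unifCgf, cgf_zero', Measure.real]

theorem unifCgf_eq {t : ℝ} (ht : t ≠ 0) : unifCgf t = Real.log ((Real.exp t - 1) / t) := by
  rw [unifCgf, cgf, mgf]
  congr 1
  simp only [id]
  rw [integral_Icc_eq_integral_Ioc, ← intervalIntegral.integral_of_le zero_le_one,
    intervalIntegral.integral_comp_mul_left (fun v => Real.exp v) ht, integral_exp]
  simp only [mul_zero, mul_one, Real.exp_zero, smul_eq_mul]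
  rw [div_eq_inv_mul]

theorem unifCgf_neg {y : ℝ} (hy : y ≠ 0) :
    unifCgf (-y) = Real.log ((1 - Real.exp (-y)) / y) := by
  rw [unifCgf_eq (neg_ne_zero.2 hy), div_neg, ← neg_div, neg_sub]

theorem monotone_unifCgf : Monotone unifCgf := by
  intro s t hst
  have : NeZero (volume.restrict (Set.Icc (0 : ℝ) 1)) := ⟨by
    rw [Ne, Measure.restrict_eq_zero]; simp⟩
  refine Real.log_le_log (mgf_pos_iff.2 (integrable_exp_mul_unif s)) ?_
  refine integral_mono_ae (integrable_exp_mul_unif s) (integrable_exp_mul_unif t) ?_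
  filter_upwards [ae_restrict_mem measurableSet_Icc] with u hu
  exact Real.exp_le_exp.2 (mul_le_mul_of_nonneg_right hst hu.1)

theorem unifCgf_neg_lt_zero {y : ℝ} (hy : 0 < y) : unifCgf (-y) < 0 := by
  rw [unifCgf_neg hy.ne']
  have h1 := Real.add_one_lt_exp (neg_ne_zero.2 hy.ne')
  have h2 : Real.exp (-y) < 1 := Real.exp_lt_one_iff.2 (by linarith)
  exact Real.log_neg (div_pos (by linarith) hy) ((div_lt_one hy).2 (by linarith))

/-! ### The exponential cost of the Hamming weight under hard decision -/

/-- The derivative of `hardCost`. -/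
noncomputable def hardSlope (β t : ℝ) : ℝ := unifCgf (β * t) - unifCgf (β * t - β)

/-- The exponential rate of decay of the probability of a noise sequence, relative to that of the
zero sequence, as a function of its normalized Hamming weight. -/
noncomputable def hardCost (β x : ℝ) : ℝ := ∫ t in (0 : ℝ)..x, hardSlope β t

section Cost

variable {β : ℝ}

theorem differentiable_hardSlope (β : ℝ) : Differentiable ℝ (hardSlope β) := by
  have h1 : Differentiable ℝ fun t : ℝ => β * t := by fun_prop
  have h2 : Differentiable ℝ fun t : ℝ => β * t - β := by fun_prop
  exact (differentiable_unifCgf.comp h1).sub (differentiable_unifCgf.comp h2)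

/-- The derivative is `β` times an increment of the monotone function `deriv unifCgf` over a step
`β`. This is the source of the convexity of the cost. -/
theorem monotone_hardSlope (hβ : 0 < β) : Monotone (hardSlope β) := by
  have hderiv : ∀ t, HasDerivAt (hardSlope β)
      (deriv unifCgf (β * t) * β - deriv unifCgf (β * t - β) * β) t := by
    intro t
    have h1 : HasDerivAt (fun t : ℝ => β * t) β t := by
      simpa using (hasDerivAt_id t).const_mul β
    exact ((differentiable_unifCgf (β * t)).hasDerivAt.comp t h1).sub
      ((differentiable_unifCgf (β * t - β)).hasDerivAt.comp t (h1.sub_const β))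
  refine monotone_of_deriv_nonneg (differentiable_hardSlope β) fun t => ?_
  rw [(hderiv t).deriv]
  have := convexOn_unifCgf.monotoneOn_deriv (fun x _ => differentiable_unifCgf x)
    (Set.mem_univ (β * t - β)) (Set.mem_univ (β * t)) (by linarith)
  nlinarith

theorem hasDerivAt_hardCost (β x : ℝ) : HasDerivAt (hardCost β) (hardSlope β x) x :=
  ((differentiable_hardSlope β).continuous.integral_hasStrictDerivAt 0 x).hasDerivAt

theorem continuous_hardCost (β : ℝ) : Continuous (hardCost β) :=
  continuous_iff_continuousAt.2 fun x => (hasDerivAt_hardCost β x).continuousAt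

theorem convexOn_hardCost (hβ : 0 < β) : ConvexOn ℝ Set.univ (hardCost β) := by
  refine Monotone.convexOn_univ_of_deriv (fun x => (hasDerivAt_hardCost β x).differentiableAt) ?_
  rw [funext fun x => (hasDerivAt_hardCost β x).deriv]
  exact monotone_hardSlope hβ

theorem hardCost_zero (β : ℝ) : hardCost β 0 = 0 := intervalIntegral.integral_same

/-- The tangent at `0`, whose slope `-unifCgf (-β)` is positive. -/
theorem exists_mul_le_hardCost (hβ : 0 < β) : ∃ γ > 0, ∀ x, γ * x ≤ hardCost β x := by
  refine ⟨-unifCgf (-β), neg_pos.2 (unifCgf_neg_lt_zero hβ), fun x => ?_⟩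
  have h := add_mul_sub_le_of_convexOn (convexOn_hardCost hβ) (hasDerivAt_hardCost β 0) x
  have h0 : hardSlope β 0 = -unifCgf (-β) := by
    simp [hardSlope, unifCgf_zero]
  rw [hardCost_zero, h0] at h
  linarith

theorem hardRatio_pos_and_log (hβ : 0 < β) {n k : ℕ} (hk : k ≤ n) :
    0 < hardRatio β n k ∧ -Real.log (hardRatio β n k) =
      ∑ j ∈ Finset.range k, unifCgf (β * (((j : ℝ) + 1) / n)) -
        ∑ j ∈ Finset.range k, unifCgf (β * ((j : ℝ) / n) - β) := by
  induction k with
  | zero => simp [hardRatio_zero]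
  | succ k ih =>
    obtain ⟨hpos, hlog⟩ := ih (by omega)
    have hkn : k < n := hk
    have hn : (0 : ℝ) < n := by exact_mod_cast (Nat.zero_le k).trans_lt hkn
    have hnk : (0 : ℝ) < n - k := sub_pos.2 (by exact_mod_cast hkn)
    have hy : 0 < β * (n - k) / n := by positivity
    have hx : 0 < β * ((k : ℝ) + 1) / n := by positivity
    have hA : 0 < (1 - Real.exp (-(β * (n - k) / n))) / (β * (n - k) / n) :=
      div_pos (sub_pos.2 (Real.exp_lt_one_iff.2 (by linarith))) hy
    have hB : 0 < (Real.exp (β * (k + 1) / n) - 1) / (β * (k + 1) / n) :=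
      div_pos (sub_pos.2 (Real.one_lt_exp_iff.2 hx)) hx
    have e1 : β * ((k : ℝ) / n) - β = -(β * (n - k) / n) := by field_simp; ring
    have e2 : β * (((k : ℝ) + 1) / n) = β * (k + 1) / n := by ring
    rw [hardRatio_succ hβ hkn]
    refine ⟨by positivity, ?_⟩
    rw [Real.log_mul hpos.ne' (div_pos hA hB).ne', Real.log_div hA.ne' hB.ne',
      Finset.sum_range_succ, Finset.sum_range_succ, e1, e2, unifCgf_neg hy.ne', unifCgf_eq hx.ne']
    linarith

/-- One right and one left Riemann sum, each off by at most the range of its integrand: `unifCgf β -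
0` and `0 - unifCgf (-β)`. -/
theorem abs_log_hardRatio_add_le (hβ : 0 < β) {n k : ℕ} (hn : 0 < n) (hk : k ≤ n) :
    |Real.log (hardRatio β n k) + n * hardCost β (k / n)| ≤ unifCgf β - unifCgf (-β) := by
  have hm1 : MonotoneOn (fun u : ℝ => unifCgf (β * u)) (Set.Icc 0 1) := fun a _ b _ hab =>
    monotone_unifCgf (mul_le_mul_of_nonneg_left hab hβ.le)
  have hm2 : MonotoneOn (fun u : ℝ => unifCgf (β * u - β)) (Set.Icc 0 1) := fun a _ b _ hab =>
    monotone_unifCgf (sub_le_sub_right (mul_le_mul_of_nonneg_left hab hβ.le) β)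
  have h1 := (abs_riemannSum_sub_integral_le hm1 hn hk).2
  have h2 := (abs_riemannSum_sub_integral_le hm2 hn hk).1
  simp only [mul_one, mul_zero, sub_self, zero_sub] at h1 h2
  have hlog := (hardRatio_pos_and_log hβ hk).2
  have hc1 : Continuous fun u : ℝ => unifCgf (β * u) :=
    differentiable_unifCgf.continuous.comp (by fun_prop)
  have hc2 : Continuous fun u : ℝ => unifCgf (β * u - β) :=
    differentiable_unifCgf.continuous.comp (by fun_prop)
  have hint : hardCost β (k / n) = (∫ u in (0 : ℝ)..(k / n : ℝ), unifCgf (β * u)) -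
      ∫ u in (0 : ℝ)..(k / n : ℝ), unifCgf (β * u - β) :=
    intervalIntegral.integral_sub (hc1.intervalIntegrable _ _) (hc2.intervalIntegrable _ _)
  rw [hint]
  have h1' := abs_le.1 h1
  have h2' := abs_le.1 h2
  rw [abs_le]
  constructor <;> linarith

/-! ### The power-sum rates under hard decision -/

/-- The power-sum rates of the hard-decision noise effect: the maximum over the normalized weight
`x` of `h x - s c x`, where `h` is the binary entropy and `c` the cost of the weight. -/
noncomputable def hardRate (β s : ℝ) : ℝ :=
  sSup ((fun x => Real.binEntropy x - s * hardCost β x) '' Set.Icc 0 1)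

theorem continuous_hardObjective (β s : ℝ) :
    Continuous fun x => Real.binEntropy x - s * hardCost β x :=
  Real.binEntropy_continuous.sub (continuous_const.mul (continuous_hardCost β))

theorem exists_hardRate_eq (β s : ℝ) :
    ∃ x ∈ Set.Icc (0 : ℝ) 1, hardRate β s = Real.binEntropy x - s * hardCost β x :=
  isCompact_Icc.exists_sSup_image_eq ⟨0, by simp⟩ (continuous_hardObjective β s).continuousOn

theorem le_hardRate (β s : ℝ) {x : ℝ} (hx : x ∈ Set.Icc (0 : ℝ) 1) :
    Real.binEntropy x - s * hardCost β x ≤ hardRate β s :=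
  le_csSup (isCompact_Icc.image (continuous_hardObjective β s)).bddAbove
    (Set.mem_image_of_mem (fun x => Real.binEntropy x - s * hardCost β x) hx)

theorem differentiableAt_hardRate (hβ : 0 < β) {s : ℝ} (hs : 0 < s) :
    DifferentiableAt ℝ (hardRate β) s := by
  have hconc : StrictConcaveOn ℝ (Set.Icc 0 1) fun x => Real.binEntropy x - s * hardCost β x := by
    have h1 : ConvexOn ℝ (Set.Icc (0 : ℝ) 1) fun x => s * hardCost β x :=
      ((convexOn_hardCost hβ).smul hs.le).subset (Set.subset_univ _) (convex_Icc 0 1)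
    exact Real.strictConcave_binEntropy.sub_convexOn h1
  obtain ⟨x₀, hx₀, hT⟩ := exists_hardRate_eq β s
  refine (hasDerivAt_of_unique_isMaxOn isCompact_Icc Real.binEntropy_continuous.continuousOn
    (continuous_hardCost β).continuousOn (exists_hardRate_eq β) (fun s x hx => le_hardRate β s hx)
    hx₀ fun x hx hne => ?_).differentiableAt
  refine (le_hardRate β s hx).lt_of_ne fun he => hne ?_
  exact hconc.eq_of_isMaxOn (fun y hy => (le_hardRate β s hy).trans_eq he.symm)
    (fun y hy => (le_hardRate β s hy).trans_eq hT) hx hx₀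

theorem hardRate_nonneg (β s : ℝ) : 0 ≤ hardRate β s := by
  simpa [hardCost_zero] using le_hardRate β s (x := 0) (by simp)

theorem tendsto_hardRate (hβ : 0 < β) : Tendsto (hardRate β) atTop (𝓝 0) := by
  obtain ⟨γ, hγ, hcost⟩ := exists_mul_le_hardCost hβ
  rw [Metric.tendsto_atTop]
  intro ε hε
  have hcont := (Real.binEntropy_continuous.tendsto 0).eventually
    (Metric.ball_mem_nhds (Real.binEntropy 0) hε)
  obtain ⟨δ, hδ, hball⟩ := Metric.eventually_nhds_iff.1 hcont
  simp only [Real.binEntropy_zero, dist_zero_right, Real.norm_eq_abs] at hball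
  refine ⟨Real.log 2 / (γ * δ), fun s hs => ?_⟩
  have hl2 : 0 < Real.log 2 := Real.log_pos (by norm_num)
  have hs0 : 0 ≤ s := le_trans (by positivity) hs
  rw [ge_iff_le, div_le_iff₀ (by positivity)] at hs
  rw [Real.dist_eq, sub_zero, abs_of_nonneg (hardRate_nonneg β s)]
  obtain ⟨x, hx, hT⟩ := exists_hardRate_eq β s
  rw [hT]
  have h1 : s * (γ * x) ≤ s * hardCost β x := mul_le_mul_of_nonneg_left (hcost x) hs0
  -- A small maximiser has small entropy; at a maximiser beyond `δ` the cost `s γ δ ≥ ln 2` already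
  -- outweighs any entropy.
  rcases lt_or_ge x δ with hxδ | hxδ
  · have h2 := (abs_lt.1 (hball (y := x) (by rwa [abs_of_nonneg hx.1]))).2
    have h3 : 0 ≤ s * (γ * x) := mul_nonneg hs0 (mul_nonneg hγ.le hx.1)
    linarith
  · have h2 := Real.binEntropy_le_log_two (p := x)
    have h3 : s * (γ * δ) ≤ s * (γ * x) :=
      mul_le_mul_of_nonneg_left (mul_le_mul_of_nonneg_left hxδ hγ.le) hs0
    linarith

theorem hardTerm_le (hβ : 0 < β) {s : ℝ} (hs : 0 < s) {n k : ℕ} (hn : 0 < n) (hk : k ≤ n) :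
    (n.choose k : ℝ) * hardRatio β n k ^ s ≤
      Real.exp (n * hardRate β s + s * (unifCgf β - unifCgf (-β))) := by
  have hn' : (0 : ℝ) < n := by exact_mod_cast hn
  have hpos := (hardRatio_pos_and_log hβ hk).1
  have h1 := (choose_bounds_exp_binEntropy hn hk).1
  have h2 := (abs_le.1 (abs_log_hardRatio_add_le hβ hn hk)).2
  have h3 := le_hardRate β s (x := k / n) ⟨by positivity, (div_le_one hn').2 (by exact_mod_cast hk)⟩
  rw [Real.rpow_def_of_pos hpos]
  refine (mul_le_mul_of_nonneg_right h1 (Real.exp_pos _).le).trans ?_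
  rw [← Real.exp_add]
  refine Real.exp_le_exp.2 ?_
  have h4 := mul_le_mul_of_nonneg_left h2 hs.le
  have h5 := mul_le_mul_of_nonneg_left h3 hn'.le
  nlinarith

theorem le_hardTerm (hβ : 0 < β) {s : ℝ} (hs : 0 < s) {n k : ℕ} (hn : 0 < n) (hk : k ≤ n) :
    Real.exp (n * (Real.binEntropy (k / n) - s * hardCost β (k / n)) -
        s * (unifCgf β - unifCgf (-β))) ≤
      (n + 1) * (n.choose k * hardRatio β n k ^ s) := by
  have hpos := (hardRatio_pos_and_log hβ hk).1
  have h1 := (choose_bounds_exp_binEntropy hn hk).2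
  have h2 := (abs_le.1 (abs_log_hardRatio_add_le hβ hn hk)).1
  rw [Real.rpow_def_of_pos hpos, ← mul_assoc]
  refine le_trans ?_ (mul_le_mul_of_nonneg_right h1 (Real.exp_pos _).le)
  rw [← Real.exp_add]
  refine Real.exp_le_exp.2 ?_
  have h4 := mul_le_mul_of_nonneg_left h2 hs.le
  nlinarith

theorem tendsto_floor_mul_div {x : ℝ} (hx : 0 ≤ x) :
    Tendsto (fun n : ℕ => (⌊x * n⌋₊ : ℝ) / n) atTop (𝓝 x) :=
  (tendsto_nat_floor_mul_div_atTop hx).comp tendsto_natCast_atTop_atTop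

theorem tendsto_inv_mul_log_add_one :
    Tendsto (fun n : ℕ => (n : ℝ)⁻¹ * Real.log (n + 1)) atTop (𝓝 0) :=
  (tendsto_inv_mul_log_one_add one_pos).congr fun n => by rw [mul_one, add_comm]

theorem tendsto_log_sum_hardNoise (hβ : 0 < β) {s : ℝ} (hs : 0 < s) :
    Tendsto (fun n : ℕ => (n : ℝ)⁻¹ *
      Real.log (∑ z, (hardNoise β n z / hardNoise β n 0) ^ s)) atTop (𝓝 (hardRate β s)) := by
  simp_rw [sum_hardNoise_div_rpow]
  -- Laplace's principle: the single weight `⌊x n⌋` at a maximiser `x` bounds the sum below, and `n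
  -- + 1` times the uniform bound on a term bounds it above.
  obtain ⟨x, hx, hT⟩ := exists_hardRate_eq β s
  set D := s * (unifCgf β - unifCgf (-β)) with hD
  have hDlim : Tendsto (fun n : ℕ => (n : ℝ)⁻¹ * D) atTop (𝓝 0) := by
    simpa using tendsto_inv_atTop_nhds_zero_nat.mul_const D
  have hlow : Tendsto (fun n : ℕ => Real.binEntropy ((⌊x * n⌋₊ : ℝ) / n) -
      s * hardCost β ((⌊x * n⌋₊ : ℝ) / n) - (n : ℝ)⁻¹ * D - (n : ℝ)⁻¹ * Real.log (n + 1)) atTop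
      (𝓝 (hardRate β s)) := by
    have h1 := ((continuous_hardObjective β s).tendsto x).comp (tendsto_floor_mul_div hx.1)
    have h2 := (h1.sub hDlim).sub tendsto_inv_mul_log_add_one
    simp only [sub_zero, ← hT] at h2
    exact h2
  have hhigh : Tendsto (fun n : ℕ => hardRate β s + (n : ℝ)⁻¹ * D +
      (n : ℝ)⁻¹ * Real.log (n + 1)) atTop (𝓝 (hardRate β s)) := by
    simpa using (hDlim.const_add (hardRate β s)).add tendsto_inv_mul_log_add_one
  have hterm : ∀ n k : ℕ, k ≤ n → 0 < (n.choose k : ℝ) * hardRatio β n k ^ s := fun n k hk =>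
    mul_pos (by exact_mod_cast Nat.choose_pos hk)
      (Real.rpow_pos_of_pos (hardRatio_pos_and_log hβ hk).1 s)
  refine tendsto_of_tendsto_of_tendsto_of_le_of_le' hlow hhigh ?_ ?_
  · filter_upwards [eventually_gt_atTop 0] with n hn
    have hn' : (0 : ℝ) < n := by exact_mod_cast hn
    set k := ⌊x * n⌋₊ with hk
    have hkn : k ≤ n := Nat.floor_le_of_le (mul_le_of_le_one_left hn'.le hx.2)
    have h1 : (n.choose k : ℝ) * hardRatio β n k ^ s ≤
        ∑ k ∈ Finset.range (n + 1), (n.choose k : ℝ) * hardRatio β n k ^ s :=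
      Finset.single_le_sum (f := fun k => (n.choose k : ℝ) * hardRatio β n k ^ s)
        (fun j hj => (hterm n j (Nat.lt_succ_iff.1 (Finset.mem_range.1 hj))).le)
        (Finset.mem_range.2 (Nat.lt_succ_iff.2 hkn))
    have h2 := Real.log_le_log (hterm n k hkn) h1
    have h3 := (Real.le_log_iff_exp_le (mul_pos (by positivity) (hterm n k hkn))).2
      (le_hardTerm hβ hs hn hkn)
    rw [Real.log_mul (by positivity) (hterm n k hkn).ne', ← hD] at h3
    rw [le_inv_mul_iff₀ hn']
    field_simp
    linarith
  · filter_upwards [eventually_gt_atTop 0] with n hn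
    have hn' : (0 : ℝ) < n := by exact_mod_cast hn
    have h1 : ∑ k ∈ Finset.range (n + 1), (n.choose k : ℝ) * hardRatio β n k ^ s ≤
        (n + 1) * Real.exp (n * hardRate β s + D) := by
      refine (Finset.sum_le_card_nsmul _ _ _ fun j hj =>
        hardTerm_le hβ hs hn (Nat.lt_succ_iff.1 (Finset.mem_range.1 hj))).trans_eq ?_
      rw [Finset.card_range, nsmul_eq_mul]
      push_cast
      ring
    have h0 : 0 < ∑ k ∈ Finset.range (n + 1), (n.choose k : ℝ) * hardRatio β n k ^ s :=
      Finset.sum_pos (fun j hj => hterm n j (Nat.lt_succ_iff.1 (Finset.mem_range.1 hj)))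
        ⟨0, by simp⟩
    have h2 := Real.log_le_log h0 h1
    rw [Real.log_mul (by positivity) (Real.exp_pos _).ne', Real.log_exp] at h2
    rw [inv_mul_le_iff₀ hn']
    field_simp
    linarith

end Cost

/-! ### The hard-decision law as an instance of the abstract power-sum hypotheses. -/

section HardPMF

variable {β : ℝ} {n : ℕ}

theorem sum_hardNoise (β : ℝ) (n : ℕ) : ∑ z, hardNoise β n z = 1 := by
  simp only [hardNoise]
  rw [← Finset.mul_sum, Finset.sum_comm]
  simp only [sum_softNoise]
  rw [Finset.sum_const, Finset.card_univ, Fintype.card_perm, Fintype.card_fin, nsmul_eq_mul,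
    mul_one, inv_mul_cancel₀ (by positivity)]

theorem hardNoise_pos (β : ℝ) (z : BitString n) : 0 < hardNoise β n z :=
  mul_pos (by positivity)
    (Finset.sum_pos (fun τ _ => softNoise_pos β τ z) Finset.univ_nonempty)

theorem hardNoise_le_zero (hβ : 0 < β) (z : BitString n) : hardNoise β n z ≤ hardNoise β n 0 :=
  mul_le_mul_of_nonneg_left (Finset.sum_le_sum fun τ _ => softNoise_le_zero hβ τ z)
    (by positivity)

theorem exp_le_hardNoise (hβ : 0 < β) (z : BitString n) :
    Real.exp (-((β + Real.log 2) * n)) ≤ hardNoise β n z := by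
  have h := Finset.card_nsmul_le_sum (Finset.univ : Finset (Equiv.Perm (Fin n))) _ _
    fun τ _ => exp_le_softNoise hβ τ z
  rw [Finset.card_univ, Fintype.card_perm, Fintype.card_fin, nsmul_eq_mul] at h
  rw [hardNoise, le_inv_mul_iff₀ (by positivity)]
  exact h

theorem hasPowerSumRates_hardNoise (hβ : 0 < β) :
    HasPowerSumRates (hardNoise β) (hardRate β) (β + Real.log 2) where
  pos _ := hardNoise_pos β
  sum_eq_one := sum_hardNoise β
  le_zero _ := hardNoise_le_zero hβ
  exp_le _ := exp_le_hardNoise hβ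
  tendsto _ hs := tendsto_log_sum_hardNoise hβ hs
  differentiableAt _ hs := differentiableAt_hardRate hβ hs
  tendsto_zero := tendsto_hardRate hβ

end HardPMF

end LRC

theorem mainTheorem4 (β : ℝ) (hβ : 0 < β) :
    (∃ (ΛN : ℝ → ℝ) (HminN H1N : ℝ),
      (∀ τ : ∀ n, Equiv.Perm (Fin n),
        LRC.HasMinEntropyRate (fun n => LRC.softNoise β (τ n)) HminN ∧
        LRC.HasShannonEntropyRate (fun n => LRC.softNoise β (τ n)) H1N ∧
        ∀ G : ∀ n, LRC.BitString n → ℕ,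
          (∀ n, LRC.IsOptimalGuessing (LRC.softNoise β (τ n)) (G n)) →
          LRC.HasSCGF (fun n => LRC.guessworkLaw (LRC.softNoise β (τ n)) (G n)) ΛN ∧
          LRC.SatisfiesLDP (fun n => LRC.guessworkLaw (LRC.softNoise β (τ n)) (G n))
            (LRC.legendreFenchel ΛN)) ∧
      LRC.IsGuessworkRateFunction (LRC.legendreFenchel ΛN) HminN H1N) ∧
    (∃ (ΛZ : ℝ → ℝ) (HminZ H1Z : ℝ),
      LRC.HasMinEntropyRate (LRC.hardNoise β) HminZ ∧
      LRC.HasShannonEntropyRate (LRC.hardNoise β) H1Z ∧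
      (∀ G : ∀ n, LRC.BitString n → ℕ,
        (∀ n, LRC.IsOptimalGuessing (LRC.hardNoise β n) (G n)) →
        LRC.HasSCGF (fun n => LRC.guessworkLaw (LRC.hardNoise β n) (G n)) ΛZ ∧
        LRC.SatisfiesLDP (fun n => LRC.guessworkLaw (LRC.hardNoise β n) (G n))
          (LRC.legendreFenchel ΛZ)) ∧
      LRC.IsGuessworkRateFunction (LRC.legendreFenchel ΛZ) HminZ H1Z) :=

  ⟨⟨LRC.guessworkSCGF (LRC.softRate β), _, _, fun τ =>
      have H := LRC.hasPowerSumRates_softNoise hβ τ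
      ⟨H.hasMinEntropyRate, H.hasShannonEntropyRate, fun _ hG => ⟨H.hasSCGF hG, H.satisfiesLDP hG⟩⟩,
      -- The rate does not involve the permutations, so the identities serve for all.
      (LRC.hasPowerSumRates_softNoise hβ fun _ => 1).isGuessworkRateFunction⟩,
    LRC.guessworkSCGF (LRC.hardRate β), _, _,
    (LRC.hasPowerSumRates_hardNoise hβ).hasMinEntropyRate,
    (LRC.hasPowerSumRates_hardNoise hβ).hasShannonEntropyRate,
    fun _ hG => ⟨(LRC.hasPowerSumRates_hardNoise hβ).hasSCGF hG,
      (LRC.hasPowerSumRates_hardNoise hβ).satisfiesLDP hG⟩,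
    (LRC.hasPowerSumRates_hardNoise hβ).isGuessworkRateFunction⟩
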